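/- Let $\Omega\subseteq\mathbb R^2$ be open and let $\alpha=\alpha(t,x)$ be a smooth real-valued solution on $\Omega$ of the backward heat equation $\alpha_t+\alpha_{xx}=0$. Consider the potential system of the heat equation $u_t=u_{xx}$ associated with the characteristic $\alpha$, $$v_x=\alpha u,\qquad v_t=\alpha u_x-\alpha_x u, \tag{S}$$ and the associated potential equation $$v_t+2\frac{\alpha_x}{\alpha}v_x-v_{xx}=0. \tag{E}$$ Let $M$ be any open set of $(t,x,u,v)$-space such that $(t,x)\in\Omega$ and $\alpha(t,x)\neq0$ at all of its points, and such that for each fixed $(t,x,v)$ the set of $u$ with $(t,x,u,v)\in M$ is an interval (possibly empty or unbounded); for instance $M=\{(t,x)\in\Omega:\alpha(t,x)\ne0\}\times\mathbb R^2$. Let $D$ be the projection of $M$ to $(t,x,v)$-space. A Lie symmetry operator of (S) on $M$ is a vector field $Q=\tau\partial_t+\xi\partial_x+\eta\partial_u+\theta\partial_v$ with smooth coefficients on $M$ which satisfies the infinitesimal invariance criterion: over $M$, its first prolongation annihilates both equations of (S) on the manifold defined by (S) in the first-order jet space. A Lie symmetry operator of (E) on $D$ is a vector field $\hat Q=\tau\partial_t+\xi\partial_x+\theta\partial_v$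 with smooth coefficients on $D$ whose second prolongation annihilates (E) on the manifold defined by (E) in the second-order jet space over $D$. Then: 1. Every Lie symmetry operator $Q$ of (S) on $M$ satisfies $\tau_u=\xi_u=\theta_u=0$, $\tau_x=\tau_v=\xi_v=\theta_{vv}=0$ and $$\eta=\Big(\theta_v-\xi_x-\frac{\alpha_t}{\alpha}\tau-\frac{\alpha_x}{\alpha}\xi\Big)u+\frac{\theta_x}{\alpha},$$ and its coefficients $\tau,\xi,\theta$ are functions of $(t,x,v)\in D$ alone. 2. Truncation $Q\mapsto\hat Q=\tau\partial_t+\xi\partial_x+\theta\partial_v$ is a bijection from the set of Lie symmetry operators of (S) on $M$ onto the set of Lie symmetry operators of (E) on $D$. Its inverse is the prolongation $\hat Q\mapsto Q=\hat Q+\eta\partial_u$, with $\eta$ given by the formula in 1. 3. The characteristic $\alpha$ yields pure potential symmetries of the heat equation (that is, (S) has on $M$ a Lie symmetry operator for which at least one of the coefficients $\tau,\xi,\eta$ depends on $v$, i.e. has a $v$-derivative that is not identically zero) if and only if (E) has on $D$ a Lie symmetry operator with $\theta_{xv}\not\equiv0$. -/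

import Mathlib

open scoped ContDiff

noncomputable section

namespace PotSym

/-- The partial derivative of `f` with respect to the `i`-th coordinate. -/
def pd {n : ℕ} (i : Fin n) (f : (Fin n → ℝ) → ℝ) (p : Fin n → ℝ) : ℝ :=
  fderiv ℝ f p (Pi.single i 1)

/-! ### Jet coordinates

* `Fin 2 → ℝ` : `(t, x)`
* `Fin 3 → ℝ` : `(t, x, v)`
* `Fin 4 → ℝ` : `(t, x, u, v)`
* `SysJet` (first jets of `(u, v)`) : `(t, x, u, v, u_t, u_x, v_t, v_x)`
* `EqJet` (second jets of `v`) : `(t, x, v, v_t, v_x, v_tt, v_tx, v_xx)`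
-/

/-- First-order jets of pairs `(u, v)`: `(t, x, u, v, u_t, u_x, v_t, v_x)`. -/
abbrev SysJet : Type := Fin 8 → ℝ

/-- Second-order jets of `v`: `(t, x, v, v_t, v_x, v_tt, v_tx, v_xx)`. -/
abbrev EqJet : Type := Fin 8 → ℝ

/-- The base point `(t, x)` of a point of any of the spaces above. -/
def tx {n : ℕ} (p : Fin (n + 2) → ℝ) : Fin 2 → ℝ := ![p 0, p 1]

/-- The projection `(t, x, u, v) ↦ (t, x, v)`. -/
def dropU (p : Fin 4 → ℝ) : Fin 3 → ℝ := ![p 0, p 1, p 3]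

/-- The backward heat equation `α_t + α_xx = 0` on `Ω`. -/
def BackwardHeat (Ω : Set (Fin 2 → ℝ)) (α : (Fin 2 → ℝ) → ℝ) : Prop :=
  ∀ z ∈ Ω, pd 0 α z + pd 1 (pd 1 α) z = 0

/-! ### The potential system and its Lie symmetry operators -/

/-- A vector field `τ ∂_t + ξ ∂_x + η ∂_u + θ ∂_v`, the coefficients being functions of
`(t, x, u, v)`. -/
structure SysField where
  τ : (Fin 4 → ℝ) → ℝ
  ξ : (Fin 4 → ℝ) → ℝ
  η : (Fin 4 → ℝ) → ℝ
  θ : (Fin 4 → ℝ) → ℝ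

namespace SysJet

/-- The point `(t, x, u, v)` below a first-order jet. -/
def base (j : SysJet) : Fin 4 → ℝ := ![j 0, j 1, j 2, j 3]

/-- The total derivative `D_t f = f_t + u_t f_u + v_t f_v` of a function of `(t, x, u, v)`. -/
def Dt (f : (Fin 4 → ℝ) → ℝ) (j : SysJet) : ℝ :=
  pd 0 f (base j) + j 4 * pd 2 f (base j) + j 6 * pd 3 f (base j)

/-- The total derivative `D_x f = f_x + u_x f_u + v_x f_v` of a function of `(t, x, u, v)`. -/
def Dx (f : (Fin 4 → ℝ) → ℝ) (j : SysJet) : ℝ :=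
  pd 1 f (base j) + j 5 * pd 2 f (base j) + j 7 * pd 3 f (base j)

end SysJet

open SysJet in
/-- The first prolongation of a vector field, at a jet; its components are those along
`∂_t, ∂_x, ∂_u, ∂_v, ∂_{u_t}, ∂_{u_x}, ∂_{v_t}, ∂_{v_x}`. -/
def SysField.pr (Q : SysField) (j : SysJet) : SysJet :=
  ![Q.τ (base j), Q.ξ (base j), Q.η (base j), Q.θ (base j),
    Dt Q.η j - j 4 * Dt Q.τ j - j 5 * Dt Q.ξ j,
    Dx Q.η j - j 4 * Dx Q.τ j - j 5 * Dx Q.ξ j,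
    Dt Q.θ j - j 6 * Dt Q.τ j - j 7 * Dt Q.ξ j,
    Dx Q.θ j - j 6 * Dx Q.τ j - j 7 * Dx Q.ξ j]

/-- `v_x - α u`, as a function on the first jet space. -/
def sysL₁ (α : (Fin 2 → ℝ) → ℝ) (j : SysJet) : ℝ :=
  j 7 - α (tx j) * j 2

/-- `v_t - (α u_x - α_x u)`, as a function on the first jet space. -/
def sysL₂ (α : (Fin 2 → ℝ) → ℝ) (j : SysJet) : ℝ :=
  j 6 - (α (tx j) * j 5 - pd 1 α (tx j) * j 2)

/-- `Q` is a Lie symmetry operator, on the open set `M` of `(t, x, u, v)`-space, of the potential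
system `v_x = α u`, `v_t = α u_x - α_x u`: its coefficients are smooth on `M` and its first
prolongation annihilates both equations on the manifold which they define in the jet space
over `M`. -/
structure IsSysSymmetry (α : (Fin 2 → ℝ) → ℝ) (M : Set (Fin 4 → ℝ)) (Q : SysField) : Prop where
  smooth_τ : ContDiffOn ℝ ∞ Q.τ M
  smooth_ξ : ContDiffOn ℝ ∞ Q.ξ M
  smooth_η : ContDiffOn ℝ ∞ Q.η M
  smooth_θ : ContDiffOn ℝ ∞ Q.θ M
  invariant : ∀ j : SysJet, SysJet.base j ∈ M → sysL₁ α j = 0 → sysL₂ α j = 0 →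
    fderiv ℝ (sysL₁ α) j (Q.pr j) = 0 ∧ fderiv ℝ (sysL₂ α) j (Q.pr j) = 0

/-- The set of Lie symmetry operators on `M` of the potential system. A vector field on `M` is
represented by the quadruple of its coefficients, extended by `0` outside `M`; so two elements are
equal exactly if they are the same vector field on `M`. -/
def sysSymmetries (α : (Fin 2 → ℝ) → ℝ) (M : Set (Fin 4 → ℝ)) : Set SysField :=
  {Q | IsSysSymmetry α M Q ∧ ∀ p ∉ M, Q.τ p = 0 ∧ Q.ξ p = 0 ∧ Q.η p = 0 ∧ Q.θ p = 0}

/-! ### The potential equation and its Lie symmetry operators -/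

/-- A vector field `τ ∂_t + ξ ∂_x + θ ∂_v`, the coefficients being functions of `(t, x, v)`. -/
structure EqField where
  τ : (Fin 3 → ℝ) → ℝ
  ξ : (Fin 3 → ℝ) → ℝ
  θ : (Fin 3 → ℝ) → ℝ

namespace EqJet

/-- The point `(t, x, v)` below a second-order jet. -/
def base (j : EqJet) : Fin 3 → ℝ := ![j 0, j 1, j 2]

/-- The total derivative `D_t f = f_t + v_t f_v` of a function of `(t, x, v)`. -/
def Dt (f : (Fin 3 → ℝ) → ℝ) (j : EqJet) : ℝ :=
  pd 0 f (base j) + j 3 * pd 2 f (base j)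

/-- The total derivative `D_x f = f_x + v_x f_v` of a function of `(t, x, v)`. -/
def Dx (f : (Fin 3 → ℝ) → ℝ) (j : EqJet) : ℝ :=
  pd 1 f (base j) + j 4 * pd 2 f (base j)

/-- The iterated total derivative
`D_t D_t f = f_tt + 2 v_t f_tv + v_t² f_vv + v_tt f_v` of a function of `(t, x, v)`. -/
def Dtt (f : (Fin 3 → ℝ) → ℝ) (j : EqJet) : ℝ :=
  pd 0 (pd 0 f) (base j) + 2 * j 3 * pd 0 (pd 2 f) (base j)
    + j 3 ^ 2 * pd 2 (pd 2 f) (base j) + j 5 * pd 2 f (base j)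

/-- The iterated total derivative
`D_t D_x f = f_tx + v_x f_tv + v_t f_xv + v_t v_x f_vv + v_tx f_v` of a function of
`(t, x, v)`. -/
def Dtx (f : (Fin 3 → ℝ) → ℝ) (j : EqJet) : ℝ :=
  pd 0 (pd 1 f) (base j) + j 4 * pd 0 (pd 2 f) (base j) + j 3 * pd 1 (pd 2 f) (base j)
    + j 3 * j 4 * pd 2 (pd 2 f) (base j) + j 6 * pd 2 f (base j)

/-- The iterated total derivative
`D_x D_x f = f_xx + 2 v_x f_xv + v_x² f_vv + v_xx f_v` of a function of `(t, x, v)`. -/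
def Dxx (f : (Fin 3 → ℝ) → ℝ) (j : EqJet) : ℝ :=
  pd 1 (pd 1 f) (base j) + 2 * j 4 * pd 1 (pd 2 f) (base j)
    + j 4 ^ 2 * pd 2 (pd 2 f) (base j) + j 7 * pd 2 f (base j)

end EqJet

open EqJet in
/-- The second prolongation of a vector field, at a jet; its components are those along
`∂_t, ∂_x, ∂_v, ∂_{v_t}, ∂_{v_x}, ∂_{v_tt}, ∂_{v_tx}, ∂_{v_xx}`. The first-order ones are
`θ^a = D_a θ - v_t D_a τ - v_x D_a ξ`, the second-order ones are
`θ^{ab} = D_a θ^b - v_{tb} D_a τ - v_{xb} D_a ξ`, written out by the Leibniz rule. -/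
def EqField.pr (Q : EqField) (j : EqJet) : EqJet :=
  ![Q.τ (base j), Q.ξ (base j), Q.θ (base j),
    Dt Q.θ j - j 3 * Dt Q.τ j - j 4 * Dt Q.ξ j,
    Dx Q.θ j - j 3 * Dx Q.τ j - j 4 * Dx Q.ξ j,
    Dtt Q.θ j - j 3 * Dtt Q.τ j - j 4 * Dtt Q.ξ j
      - 2 * j 5 * Dt Q.τ j - 2 * j 6 * Dt Q.ξ j,
    Dtx Q.θ j - j 3 * Dtx Q.τ j - j 4 * Dtx Q.ξ j
      - j 5 * Dx Q.τ j - j 6 * Dx Q.ξ j - j 6 * Dt Q.τ j - j 7 * Dt Q.ξ j,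
    Dxx Q.θ j - j 3 * Dxx Q.τ j - j 4 * Dxx Q.ξ j
      - 2 * j 6 * Dx Q.τ j - 2 * j 7 * Dx Q.ξ j]

/-- `v_t + 2 (α_x / α) v_x - v_xx`, as a function on the second jet space. -/
def eqL (α : (Fin 2 → ℝ) → ℝ) (j : EqJet) : ℝ :=
  j 3 + 2 * (pd 1 α (tx j) / α (tx j)) * j 4 - j 7

/-- `Q` is a Lie symmetry operator, on the open set `D` of `(t, x, v)`-space, of the potential
equation `v_t + 2 (α_x / α) v_x - v_xx = 0`: its coefficients are smooth on `D` and its second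
prolongation annihilates the equation on the manifold which it defines in the jet space
over `D`. -/
structure IsEqSymmetry (α : (Fin 2 → ℝ) → ℝ) (D : Set (Fin 3 → ℝ)) (Q : EqField) : Prop where
  smooth_τ : ContDiffOn ℝ ∞ Q.τ D
  smooth_ξ : ContDiffOn ℝ ∞ Q.ξ D
  smooth_θ : ContDiffOn ℝ ∞ Q.θ D
  invariant : ∀ j : EqJet, EqJet.base j ∈ D → eqL α j = 0 → fderiv ℝ (eqL α) j (Q.pr j) = 0

/-- The set of Lie symmetry operators on `D` of the potential equation; vector fields on `D` are
represented by their coefficients, extended by `0` outside `D`. -/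
def eqSymmetries (α : (Fin 2 → ℝ) → ℝ) (D : Set (Fin 3 → ℝ)) : Set EqField :=
  {Q | IsEqSymmetry α D Q ∧ ∀ d ∉ D, Q.τ d = 0 ∧ Q.ξ d = 0 ∧ Q.θ d = 0}

/-! ### Truncation, prolongation to `u`, potential symmetries -/

/-- The function on the projection of `M` to `(t, x, v)`-space which `f` induces: its value at `d`
is the value of `f` at a point of `M` above `d` (any such point, if `f` does not depend on `u`);
it is `0` where there is no such point. -/
def truncFun (M : Set (Fin 4 → ℝ)) (f : (Fin 4 → ℝ) → ℝ) : (Fin 3 → ℝ) → ℝ :=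
  Function.extend (fun p : M => dropU p) (fun p : M => f p) 0

/-- Truncation `τ ∂_t + ξ ∂_x + η ∂_u + θ ∂_v ↦ τ ∂_t + ξ ∂_x + θ ∂_v`. -/
def truncate (M : Set (Fin 4 → ℝ)) (Q : SysField) : EqField where
  τ := truncFun M Q.τ
  ξ := truncFun M Q.ξ
  θ := truncFun M Q.θ

/-- Prolongation `τ ∂_t + ξ ∂_x + θ ∂_v ↦ τ ∂_t + ξ ∂_x + η ∂_u + θ ∂_v` to `u`, on `M`, with
`η = (θ_v - ξ_x - (α_t / α) τ - (α_x / α) ξ) u + θ_x / α`. -/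
def prolong (α : (Fin 2 → ℝ) → ℝ) (M : Set (Fin 4 → ℝ)) (Q : EqField) : SysField where
  τ := M.indicator fun p => Q.τ (dropU p)
  ξ := M.indicator fun p => Q.ξ (dropU p)
  η := M.indicator fun p =>
    (pd 2 Q.θ (dropU p) - pd 1 Q.ξ (dropU p) - pd 0 α (tx p) / α (tx p) * Q.τ (dropU p)
        - pd 1 α (tx p) / α (tx p) * Q.ξ (dropU p)) * p 2
      + pd 1 Q.θ (dropU p) / α (tx p)
  θ := M.indicator fun p => Q.θ (dropU p)

/-- At least one of the coefficients of `∂_t`, `∂_x`, `∂_u` depends on the potential `v`. For a Lie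
symmetry operator of the potential system this means that it is a pure potential symmetry
of the heat equation `u_t = u_xx`. -/
def IsPurePotential (M : Set (Fin 4 → ℝ)) (Q : SysField) : Prop :=
  ∃ p ∈ M, pd 3 Q.τ p ≠ 0 ∨ pd 3 Q.ξ p ≠ 0 ∨ pd 3 Q.η p ≠ 0

end PotSym

end

/-!
Both invariance criteria split into explicit systems of linear partial differential equations for
the coefficients, and these two systems turn out to be the same.

For the potential equation, `v_xx` is eliminated and the criterion becomes a polynomial in `v_t`,
`v_x`, `v_tx` that has to vanish identically. Its coefficients give
`τ_x = τ_v = ξ_v = θ_vv = 0`, `τ_t = 2 ξ_x`, one equation that expresses `θ_xv` through `τ`, `ξ`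
and `α`, and the statement that, for fixed `v`, `θ` satisfies the potential equation
(`EqDet`, `isEqSymmetry_iff`).

For the potential system, `v_t` and `v_x` are eliminated and the criteria become polynomials in `u_t`
and `u_x`. The coefficient of `u_x ^ 2` in the first one is `τ_u = 0`; comparing the coefficient of
`u_x` there with that of `u_t` in the second one gives `τ_x + α u τ_v = 0`, which splits with
respect to `u` because `τ` does not depend on `u`. Then `ξ_u = θ_u = 0`, what is left of the first
criterion is the formula for `η`, and what is left of the second one is affine and then quadratic in
`u` with coefficients free of `u`. Splitting with respect to `u` (`coeff_eq_zero_of_quadratic`)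
leaves the equations found for the potential equation, together with the formula for `η`
(`SysDet`, `isSysSymmetry_iff`). Both splittings are equivalences, so nothing has to be checked
separately for prolonged fields.

As the fibres of `M` over `(t, x, v)`-space are intervals, functions on `M` without `u`-derivative
descend to the projection of `M` (`UFree.truncFun_dropU`), and stay smooth there because the
projection has local sections with constant `u`. This identifies the two sets of operators
(`sysDet_iff_eqDet`). Finally, the formula for `η` and `θ_vv = 0` give `η_v = θ_xv / α`, which is
the only `v`-derivative of `τ`, `ξ`, `η` that can be nonzero (`isPurePotential_iff`).
-/

noncomputable section

namespace PotSym

/-! ### Partial derivatives -/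

/-- `f` has partial derivative `f'` with respect to the `i`-th coordinate at `p`. -/
def HasPd {n : ℕ} (i : Fin n) (f : (Fin n → ℝ) → ℝ) (f' : ℝ) (p : Fin n → ℝ) : Prop :=
  HasLineDerivAt ℝ f f' p (Pi.single i 1)

section HasPd

variable {n : ℕ} {i : Fin n} {f g : (Fin n → ℝ) → ℝ} {f' g' : ℝ} {p : Fin n → ℝ}

theorem HasPd.add (hf : HasPd i f f' p) (hg : HasPd i g g' p) :
    HasPd i (fun q => f q + g q) (f' + g') p :=
  HasDerivAt.add hf hg

theorem HasPd.sub (hf : HasPd i f f' p) (hg : HasPd i g g' p) :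
    HasPd i (fun q => f q - g q) (f' - g') p :=
  HasDerivAt.sub hf hg

theorem HasPd.mul (hf : HasPd i f f' p) (hg : HasPd i g g' p) :
    HasPd i (fun q => f q * g q) (f' * g p + f p * g') p := by
  have h := HasDerivAt.mul hf hg
  simp only [zero_smul, add_zero] at h
  exact h

theorem HasPd.unique (hf : HasPd i f f' p) (hg : HasPd i f g' p) : f' = g' :=
  HasLineDerivAt.unique hf hg

theorem hasPd_coord_self (i : Fin n) (p : Fin n → ℝ) : HasPd i (fun q => q i) 1 p := by
  have h : HasDerivAt (fun s : ℝ => p i + s * 1) 1 0 := by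
    simpa using (hasDerivAt_id (0 : ℝ)).const_add (p i)
  simpa [HasPd, HasLineDerivAt] using h

theorem hasPd_coord_of_ne {i k : Fin n} (hik : k ≠ i) (p : Fin n → ℝ) :
    HasPd i (fun q => q k) 0 p := by
  have h : HasDerivAt (fun _ : ℝ => p k) 0 0 := hasDerivAt_const _ _
  simpa [HasPd, HasLineDerivAt, hik] using h

theorem HasPd.congr_of_eqOn {M : Set (Fin n → ℝ)} (hM : IsOpen M) (hp : p ∈ M)
    (hf : HasPd i f f' p) (hfg : Set.EqOn g f M) : HasPd i g f' p :=
  HasLineDerivAt.congr_of_eventuallyEq hf (hfg.eventuallyEq_of_mem (hM.mem_nhds hp))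

theorem hasPd_pd (hf : DifferentiableAt ℝ f p) (i : Fin n) : HasPd i f (pd i f p) p :=
  hf.hasFDerivAt.hasLineDerivAt _

theorem HasPd.pd_eq (hf : HasPd i f f' p) (hd : DifferentiableAt ℝ f p) : pd i f p = f' :=
  (hasPd_pd hd i).unique hf

end HasPd

section Smooth

variable {n : ℕ} {M : Set (Fin n → ℝ)} {f g : (Fin n → ℝ) → ℝ} {p : Fin n → ℝ}

theorem differentiableAt_of_contDiffOn (hM : IsOpen M) (hf : ContDiffOn ℝ ∞ f M) (hp : p ∈ M) :
    DifferentiableAt ℝ f p :=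
  ((hf p hp).contDiffAt (hM.mem_nhds hp)).differentiableAt (by simp)

theorem hasPd_of_contDiffOn (hM : IsOpen M) (hf : ContDiffOn ℝ ∞ f M) (hp : p ∈ M) (i : Fin n) :
    HasPd i f (pd i f p) p :=
  hasPd_pd (differentiableAt_of_contDiffOn hM hf hp) i

theorem contDiffOn_pd (hM : IsOpen M) (hf : ContDiffOn ℝ ∞ f M) (i : Fin n) :
    ContDiffOn ℝ ∞ (pd i f) M :=
  (hf.fderiv_of_isOpen hM (by simp)).clm_apply contDiffOn_const

theorem pd_congr (hM : IsOpen M) (hp : p ∈ M) (hfg : Set.EqOn f g M) (i : Fin n) :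
    pd i f p = pd i g p := by
  unfold pd
  rw [(hfg.eventuallyEq_of_mem (hM.mem_nhds hp)).fderiv_eq]

theorem pd_eq_zero_of_eqOn (hM : IsOpen M) (hp : p ∈ M) (hf : ∀ q ∈ M, f q = 0) (i : Fin n) :
    pd i f p = 0 := by
  rw [pd_congr (g := fun _ => 0) hM hp hf i]
  simp [pd]

theorem pd_comm (hM : IsOpen M) (hf : ContDiffOn ℝ ∞ f M) (hp : p ∈ M) (i k : Fin n) :
    pd i (pd k f) p = pd k (pd i f) p := by
  have hc : ContDiffAt ℝ ∞ f p := (hf p hp).contDiffAt (hM.mem_nhds hp)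
  have hd : DifferentiableAt ℝ (fderiv ℝ f) p :=
    (hc.fderiv_right (m := ∞) (by simp)).differentiableAt (by simp)
  have key : ∀ a b : Fin n,
      pd a (pd b f) p = fderiv ℝ (fderiv ℝ f) p (Pi.single a 1) (Pi.single b 1) := by
    intro a b
    have h := (hd.hasFDerivAt.clm_apply
      (hasFDerivAt_const (Pi.single b (1 : ℝ) : Fin n → ℝ) p)).fderiv
    change fderiv ℝ (fun q => fderiv ℝ f q (Pi.single b 1)) p (Pi.single a 1) = _
    rw [h]
    simp
  rw [key, key]
  exact (hc.isSymmSndFDerivAt (by simpa using WithTop.coe_le_coe.2 (le_top (a := (2 : ℕ∞))))) _ _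

/-- The chain rule for an inner map whose `i`-th partial derivative is the `k`-th basis vector. -/
theorem pd_comp_of_basis {m : ℕ} {L : (Fin n → ℝ) →L[ℝ] (Fin m → ℝ)}
    {f : (Fin m → ℝ) → ℝ} (hf : DifferentiableAt ℝ f (L p)) {i : Fin n} {k : Fin m}
    (hL : L (Pi.single i 1) = Pi.single k 1) : pd i (fun q => f (L q)) p = pd k f (L p) := by
  unfold pd
  rw [← hL]
  have := (hf.hasFDerivAt.comp p L.hasFDerivAt).fderiv
  change fderiv ℝ (f ∘ L) p _ = _
  rw [this]; rfl

theorem pd_comp_of_zero {m : ℕ} {L : (Fin n → ℝ) →L[ℝ] (Fin m → ℝ)}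
    {f : (Fin m → ℝ) → ℝ} (hf : DifferentiableAt ℝ f (L p)) {i : Fin n}
    (hL : L (Pi.single i 1) = 0) : pd i (fun q => f (L q)) p = 0 := by
  unfold pd
  have := (hf.hasFDerivAt.comp p L.hasFDerivAt).fderiv
  change fderiv ℝ (f ∘ L) p _ = _
  rw [this]; simp [hL]

end Smooth

/-! ### The coordinate projections -/

/-- `tx` as a continuous linear map. -/
def txL (n : ℕ) : (Fin (n + 2) → ℝ) →L[ℝ] (Fin 2 → ℝ) :=
  ContinuousLinearMap.pi ![ContinuousLinearMap.proj 0, ContinuousLinearMap.proj 1]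

theorem txL_apply {n : ℕ} (p : Fin (n + 2) → ℝ) : txL n p = tx p := by
  ext i; fin_cases i <;> rfl

/-- `dropU` as a continuous linear map. -/
def dropUL : (Fin 4 → ℝ) →L[ℝ] (Fin 3 → ℝ) :=
  ContinuousLinearMap.pi ![ContinuousLinearMap.proj 0, ContinuousLinearMap.proj 1,
    ContinuousLinearMap.proj 3]

theorem dropUL_apply (p : Fin 4 → ℝ) : dropUL p = dropU p := by
  ext i; fin_cases i <;> rfl

theorem contDiff_tx {n : ℕ} : ContDiff ℝ ∞ (tx : (Fin (n + 2) → ℝ) → Fin 2 → ℝ) := by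
  have h : ContDiff ℝ ∞ (txL n) := (txL n).contDiff
  rwa [show ⇑(txL n) = tx from funext txL_apply] at h

theorem contDiff_dropU : ContDiff ℝ ∞ dropU := by
  have h : ContDiff ℝ ∞ dropUL := dropUL.contDiff
  rwa [show ⇑dropUL = dropU from funext dropUL_apply] at h

theorem tx_dropU (p : Fin 4 → ℝ) : tx (dropU p) = tx p := by
  ext i; fin_cases i <;> rfl

section PdProjection

variable {f : (Fin 2 → ℝ) → ℝ} {g : (Fin 3 → ℝ) → ℝ} {p : Fin 4 → ℝ}

theorem pd_tx (hf : DifferentiableAt ℝ f (tx p)) :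
    pd 0 (fun q : Fin 4 → ℝ => f (tx q)) p = pd 0 f (tx p) ∧
    pd 1 (fun q : Fin 4 → ℝ => f (tx q)) p = pd 1 f (tx p) ∧
    pd 2 (fun q : Fin 4 → ℝ => f (tx q)) p = 0 ∧
    pd 3 (fun q : Fin 4 → ℝ => f (tx q)) p = 0 := by
  simp only [← txL_apply (n := 2)] at hf ⊢
  refine ⟨pd_comp_of_basis hf ?_, pd_comp_of_basis hf ?_, pd_comp_of_zero hf ?_,
    pd_comp_of_zero hf ?_⟩ <;>
  · ext i; fin_cases i <;> simp [txL_apply, tx]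

theorem pd_dropU (hg : DifferentiableAt ℝ g (dropU p)) :
    pd 0 (fun q => g (dropU q)) p = pd 0 g (dropU p) ∧
    pd 1 (fun q => g (dropU q)) p = pd 1 g (dropU p) ∧
    pd 2 (fun q => g (dropU q)) p = 0 ∧
    pd 3 (fun q => g (dropU q)) p = pd 2 g (dropU p) := by
  simp only [← dropUL_apply] at hg ⊢
  refine ⟨pd_comp_of_basis hg ?_, pd_comp_of_basis hg ?_, pd_comp_of_zero hg ?_,
    pd_comp_of_basis hg ?_⟩ <;>
  · ext i; fin_cases i <;> simp [dropUL_apply, dropU]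

end PdProjection

/-- The differential of `f (t, x)` along a vector of any of the coordinate spaces. -/
theorem hasFDerivAt_comp_tx {n : ℕ} {f : (Fin 2 → ℝ) → ℝ} {p : Fin (n + 2) → ℝ}
    (hf : DifferentiableAt ℝ f (tx p)) :
    ∃ L : (Fin (n + 2) → ℝ) →L[ℝ] ℝ, HasFDerivAt (fun q => f (tx q)) L p ∧
      ∀ w, L w = w 0 * pd 0 f (tx p) + w 1 * pd 1 f (tx p) := by
  refine ⟨(fderiv ℝ f (tx p)).comp (txL n), ?_, fun w => ?_⟩
  · rw [← txL_apply] at hf ⊢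
    exact (hf.hasFDerivAt.comp p (txL n).hasFDerivAt).congr_of_eventuallyEq
      (.of_forall fun q => by simp [txL_apply])
  · have : txL n w = w 0 • Pi.single 0 1 + w 1 • Pi.single 1 1 := by
      rw [txL_apply]; ext i; fin_cases i <;> simp [tx]
    rw [ContinuousLinearMap.comp_apply, this, map_add, map_smul, map_smul]
    rfl

/-! ### The invariance criterion of the potential system, written out -/

theorem sysL_fderiv {α : (Fin 2 → ℝ) → ℝ} {j : SysJet}
    (hα : DifferentiableAt ℝ α (tx j)) (hα₁ : DifferentiableAt ℝ (pd 1 α) (tx j)) (w : SysJet) :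
    fderiv ℝ (sysL₁ α) j w
      = w 7 - ((w 0 * pd 0 α (tx j) + w 1 * pd 1 α (tx j)) * j 2 + α (tx j) * w 2) ∧
    fderiv ℝ (sysL₂ α) j w
      = w 6 - ((w 0 * pd 0 α (tx j) + w 1 * pd 1 α (tx j)) * j 5 + α (tx j) * w 5
        - ((w 0 * pd 0 (pd 1 α) (tx j) + w 1 * pd 1 (pd 1 α) (tx j)) * j 2
          + pd 1 α (tx j) * w 2)) := by
  obtain ⟨L, hL, hLw⟩ := hasFDerivAt_comp_tx hα
  obtain ⟨L₁, hL₁, hLw₁⟩ := hasFDerivAt_comp_tx hα₁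
  have hc : ∀ k : Fin 8, HasFDerivAt (fun j : SysJet => j k)
      (ContinuousLinearMap.proj k : SysJet →L[ℝ] ℝ) j := fun k => hasFDerivAt_apply k j
  have h₁ := (hc 7).sub (hL.mul (hc 2))
  have h₂ := (hc 6).sub ((hL.mul (hc 5)).sub (hL₁.mul (hc 2)))
  constructor
  · change fderiv ℝ (fun j : SysJet => j 7 - α (tx j) * j 2) j w = _
    refine (congrArg (· w) h₁.fderiv).trans ?_
    simp [hLw]; ring
  · change fderiv ℝ
      (fun j : SysJet => j 6 - (α (tx j) * j 5 - pd 1 α (tx j) * j 2)) j w = _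
    refine (congrArg (· w) h₂.fderiv).trans ?_
    simp [hLw, hLw₁]; ring

/-- The invariance criterion for `v_x = α u` at the point `p` and the jet with `u_x = q` and with
`v_t`, `v_x` given by the potential system; `u_t` does not occur. -/
def sysCrit₁ (α : (Fin 2 → ℝ) → ℝ) (Q : SysField) (p : Fin 4 → ℝ) (q : ℝ) : ℝ :=
  (pd 1 Q.θ p + q * pd 2 Q.θ p + α (tx p) * p 2 * pd 3 Q.θ p)
    - (α (tx p) * q - pd 1 α (tx p) * p 2)
      * (pd 1 Q.τ p + q * pd 2 Q.τ p + α (tx p) * p 2 * pd 3 Q.τ p)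
    - α (tx p) * p 2 * (pd 1 Q.ξ p + q * pd 2 Q.ξ p + α (tx p) * p 2 * pd 3 Q.ξ p)
    - (Q.τ p * pd 0 α (tx p) + Q.ξ p * pd 1 α (tx p)) * p 2 - α (tx p) * Q.η p

/-- The invariance criterion for `v_t = α u_x - α_x u` at the point `p` and the jet with
`u_t = a`, `u_x = q` and with `v_t`, `v_x` given by the potential system. -/
def sysCrit₂ (α : (Fin 2 → ℝ) → ℝ) (Q : SysField) (p : Fin 4 → ℝ) (a q : ℝ) : ℝ :=
  (pd 0 Q.θ p + a * pd 2 Q.θ p + (α (tx p) * q - pd 1 α (tx p) * p 2) * pd 3 Q.θ p)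
    - (α (tx p) * q - pd 1 α (tx p) * p 2)
      * (pd 0 Q.τ p + a * pd 2 Q.τ p + (α (tx p) * q - pd 1 α (tx p) * p 2) * pd 3 Q.τ p)
    - α (tx p) * p 2
      * (pd 0 Q.ξ p + a * pd 2 Q.ξ p + (α (tx p) * q - pd 1 α (tx p) * p 2) * pd 3 Q.ξ p)
    - (Q.τ p * pd 0 α (tx p) + Q.ξ p * pd 1 α (tx p)) * q
    - α (tx p) * ((pd 1 Q.η p + q * pd 2 Q.η p + α (tx p) * p 2 * pd 3 Q.η p)
      - a * (pd 1 Q.τ p + q * pd 2 Q.τ p + α (tx p) * p 2 * pd 3 Q.τ p)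
      - q * (pd 1 Q.ξ p + q * pd 2 Q.ξ p + α (tx p) * p 2 * pd 3 Q.ξ p))
    + (Q.τ p * pd 0 (pd 1 α) (tx p) + Q.ξ p * pd 1 (pd 1 α) (tx p)) * p 2
    + pd 1 α (tx p) * Q.η p

theorem sys_invariant_iff {α : (Fin 2 → ℝ) → ℝ} {M : Set (Fin 4 → ℝ)} (Q : SysField)
    (hα : ∀ p ∈ M, DifferentiableAt ℝ α (tx p))
    (hα₁ : ∀ p ∈ M, DifferentiableAt ℝ (pd 1 α) (tx p)) :
    (∀ j : SysJet, SysJet.base j ∈ M → sysL₁ α j = 0 → sysL₂ α j = 0 →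
      fderiv ℝ (sysL₁ α) j (Q.pr j) = 0 ∧ fderiv ℝ (sysL₂ α) j (Q.pr j) = 0) ↔
    ∀ p ∈ M, ∀ a q : ℝ, sysCrit₁ α Q p q = 0 ∧ sysCrit₂ α Q p a q = 0 := by
  have htx : ∀ j : SysJet, tx (SysJet.base j) = tx j := fun j => by
    ext i; fin_cases i <;> rfl
  -- on the manifold defined by the system the criterion is the pair of polynomials above
  have key : ∀ j : SysJet, SysJet.base j ∈ M → sysL₁ α j = 0 → sysL₂ α j = 0 →
      fderiv ℝ (sysL₁ α) j (Q.pr j) = sysCrit₁ α Q (SysJet.base j) (j 5) ∧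
      fderiv ℝ (sysL₂ α) j (Q.pr j) = sysCrit₂ α Q (SysJet.base j) (j 4) (j 5) := by
    intro j hj h₁ h₂
    have d := hα _ hj
    have d₁ := hα₁ _ hj
    rw [htx] at d d₁
    have h7 : j 7 = α (tx j) * j 2 := by unfold sysL₁ at h₁; linarith
    have h6 : j 6 = α (tx j) * j 5 - pd 1 α (tx j) * j 2 := by unfold sysL₂ at h₂; linarith
    have hb : SysJet.base j 2 = j 2 := rfl
    rw [(sysL_fderiv d d₁ _).1, (sysL_fderiv d d₁ _).2]
    simp only [sysCrit₁, sysCrit₂, htx, hb, SysField.pr, SysJet.Dt, SysJet.Dx,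
      Matrix.cons_val, h6, h7]
    constructor <;> ring
  constructor
  · intro h p hp a q
    let j : SysJet := ![p 0, p 1, p 2, p 3, a, q,
      α (tx p) * q - pd 1 α (tx p) * p 2, α (tx p) * p 2]
    have hb : SysJet.base j = p := by ext i; fin_cases i <;> rfl
    have ht : tx j = tx p := rfl
    have h₁ : sysL₁ α j = 0 := by
      change α (tx p) * p 2 - α (tx p) * p 2 = 0; ring
    have h₂ : sysL₂ α j = 0 := sub_self _
    have hj : SysJet.base j ∈ M := by rwa [hb]
    have := h j hj h₁ h₂
    rwa [(key j hj h₁ h₂).1, (key j hj h₁ h₂).2, hb] at this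
  · intro h j hj h₁ h₂
    rw [(key j hj h₁ h₂).1, (key j hj h₁ h₂).2]
    exact h _ hj _ _

/-! ### The potential equation -/

theorem eqL_fderiv {α : (Fin 2 → ℝ) → ℝ} {j : EqJet} (h0 : α (tx j) ≠ 0)
    (hα : DifferentiableAt ℝ α (tx j)) (hα₁ : DifferentiableAt ℝ (pd 1 α) (tx j)) (w : EqJet) :
    fderiv ℝ (eqL α) j w
      = w 3 + 2 * ((w 0 * pd 0 (pd 1 α) (tx j) + w 1 * pd 1 (pd 1 α) (tx j)) / α (tx j)
          - pd 1 α (tx j) * (w 0 * pd 0 α (tx j) + w 1 * pd 1 α (tx j)) / α (tx j) ^ 2) * j 4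
        + 2 * (pd 1 α (tx j) / α (tx j)) * w 4 - w 7 := by
  obtain ⟨L, hL, hLw⟩ := hasFDerivAt_comp_tx hα
  obtain ⟨L₁, hL₁, hLw₁⟩ := hasFDerivAt_comp_tx hα₁
  have hc : ∀ k : Fin 8, HasFDerivAt (fun j : EqJet => j k)
      (ContinuousLinearMap.proj k : EqJet →L[ℝ] ℝ) j := fun k => hasFDerivAt_apply k j
  have hinv := (hasDerivAt_inv h0).comp_hasFDerivAt j hL
  have h := ((hc 3).add (((hL₁.mul hinv).const_mul 2).mul (hc 4))).sub (hc 7)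
  have hfun : eqL α = fun j : EqJet => j 3 + 2 * (pd 1 α (tx j) * (α (tx j))⁻¹) * j 4 - j 7 := by
    ext j; simp [eqL, div_eq_mul_inv]
  rw [hfun]
  refine (congrArg (· w) h.fderiv).trans ?_
  simp [hLw, hLw₁]
  field_simp
  ring

/-- The determining equations of the Lie symmetry operators of the potential equation, at a
point; the last two are multiplied by powers of `α` to clear denominators. -/
structure EqDet (α : (Fin 2 → ℝ) → ℝ) (Q : EqField) (d : Fin 3 → ℝ) : Prop where
  τ_x : pd 1 Q.τ d = 0
  τ_v : pd 2 Q.τ d = 0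
  ξ_v : pd 2 Q.ξ d = 0
  θ_vv : pd 2 (pd 2 Q.θ) d = 0
  τ_t : pd 0 Q.τ d = 2 * pd 1 Q.ξ d
  θ_xv : 2 * α (tx d) ^ 2 * pd 1 (pd 2 Q.θ) d =
    -α (tx d) ^ 2 * pd 0 Q.ξ d
      + 2 * (pd 0 (pd 1 α) (tx d) * α (tx d) - pd 1 α (tx d) * pd 0 α (tx d)) * Q.τ d
      + 2 * (pd 1 (pd 1 α) (tx d) * α (tx d) - pd 1 α (tx d) ^ 2) * Q.ξ d
      + 2 * pd 1 α (tx d) * α (tx d) * pd 1 Q.ξ d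
  θ_t : α (tx d) * (pd 0 Q.θ d - pd 1 (pd 1 Q.θ) d) + 2 * pd 1 α (tx d) * pd 1 Q.θ d = 0

/-- The invariance criterion for the potential equation at the point `d` and the jet with
`v_t = a`, `v_x = b`, `v_tx = c` and with `v_xx` given by the equation. -/
def eqCrit (α : (Fin 2 → ℝ) → ℝ) (Q : EqField) (d : Fin 3 → ℝ) (a b c : ℝ) : ℝ :=
  (pd 0 Q.θ d + a * pd 2 Q.θ d - a * (pd 0 Q.τ d + a * pd 2 Q.τ d)
      - b * (pd 0 Q.ξ d + a * pd 2 Q.ξ d))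
    + 2 * ((Q.τ d * pd 0 (pd 1 α) (tx d) + Q.ξ d * pd 1 (pd 1 α) (tx d)) / α (tx d)
      - pd 1 α (tx d) * (Q.τ d * pd 0 α (tx d) + Q.ξ d * pd 1 α (tx d)) / α (tx d) ^ 2) * b
    + 2 * (pd 1 α (tx d) / α (tx d))
      * (pd 1 Q.θ d + b * pd 2 Q.θ d - a * (pd 1 Q.τ d + b * pd 2 Q.τ d)
        - b * (pd 1 Q.ξ d + b * pd 2 Q.ξ d))
    - (pd 1 (pd 1 Q.θ) d + 2 * b * pd 1 (pd 2 Q.θ) d + b ^ 2 * pd 2 (pd 2 Q.θ) d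
        + (a + 2 * (pd 1 α (tx d) / α (tx d)) * b) * pd 2 Q.θ d
      - a * (pd 1 (pd 1 Q.τ) d + 2 * b * pd 1 (pd 2 Q.τ) d + b ^ 2 * pd 2 (pd 2 Q.τ) d
        + (a + 2 * (pd 1 α (tx d) / α (tx d)) * b) * pd 2 Q.τ d)
      - b * (pd 1 (pd 1 Q.ξ) d + 2 * b * pd 1 (pd 2 Q.ξ) d + b ^ 2 * pd 2 (pd 2 Q.ξ) d
        + (a + 2 * (pd 1 α (tx d) / α (tx d)) * b) * pd 2 Q.ξ d)
      - 2 * c * (pd 1 Q.τ d + b * pd 2 Q.τ d)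
      - 2 * (a + 2 * (pd 1 α (tx d) / α (tx d)) * b) * (pd 1 Q.ξ d + b * pd 2 Q.ξ d))

theorem eq_invariant_iff {α : (Fin 2 → ℝ) → ℝ} {D : Set (Fin 3 → ℝ)} (Q : EqField)
    (h0 : ∀ d ∈ D, α (tx d) ≠ 0) (hα : ∀ d ∈ D, DifferentiableAt ℝ α (tx d))
    (hα₁ : ∀ d ∈ D, DifferentiableAt ℝ (pd 1 α) (tx d)) :
    (∀ j : EqJet, EqJet.base j ∈ D → eqL α j = 0 → fderiv ℝ (eqL α) j (Q.pr j) = 0) ↔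
    ∀ d ∈ D, ∀ a b c : ℝ, eqCrit α Q d a b c = 0 := by
  have htx : ∀ j : EqJet, tx (EqJet.base j) = tx j := fun j => by
    ext i; fin_cases i <;> rfl
  have key : ∀ j : EqJet, EqJet.base j ∈ D → eqL α j = 0 →
      fderiv ℝ (eqL α) j (Q.pr j) = eqCrit α Q (EqJet.base j) (j 3) (j 4) (j 6) := by
    intro j hj h
    have d0 := h0 _ hj
    have d := hα _ hj
    have d₁ := hα₁ _ hj
    rw [htx] at d0 d d₁
    have h7 : j 7 = j 3 + 2 * (pd 1 α (tx j) / α (tx j)) * j 4 := by unfold eqL at h; linarith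
    rw [eqL_fderiv d0 d d₁]
    simp only [eqCrit, htx, EqField.pr, EqJet.Dt, EqJet.Dx, EqJet.Dxx, Matrix.cons_val, h7]
  constructor
  · intro h d hd a b c
    let j : EqJet := ![d 0, d 1, d 2, a, b, 0, c,
      a + 2 * (pd 1 α (tx d) / α (tx d)) * b]
    have hb : EqJet.base j = d := by ext i; fin_cases i <;> rfl
    have h₁ : eqL α j = 0 := sub_self _
    have hj : EqJet.base j ∈ D := by rwa [hb]
    have := h j hj h₁
    rwa [key j hj h₁, hb] at this
  · intro h j hj h₁
    rw [key j hj h₁]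
    exact h _ hj _ _ _

/-- The invariance criterion of the potential equation, a polynomial in `v_t`, `v_x`, `v_tx`,
splits into the determining equations. -/
theorem isEqSymmetry_iff {α : (Fin 2 → ℝ) → ℝ} {D : Set (Fin 3 → ℝ)} (hD : IsOpen D)
    (Q : EqField) (h0 : ∀ d ∈ D, α (tx d) ≠ 0) (hα : ∀ d ∈ D, DifferentiableAt ℝ α (tx d))
    (hα₁ : ∀ d ∈ D, DifferentiableAt ℝ (pd 1 α) (tx d)) :
    IsEqSymmetry α D Q ↔ (ContDiffOn ℝ ∞ Q.τ D ∧ ContDiffOn ℝ ∞ Q.ξ D ∧ ContDiffOn ℝ ∞ Q.θ D) ∧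
      ∀ d ∈ D, EqDet α Q d := by
  have zero : ∀ f : (Fin 3 → ℝ) → ℝ, ∀ i, (∀ d ∈ D, f d = 0) → ∀ d ∈ D, pd i f d = 0 :=
    fun f i hf d hd => pd_eq_zero_of_eqOn hD hd hf i
  -- `2 ξ_xx = τ_tx = 0`
  have ξxx : ContDiffOn ℝ ∞ Q.τ D → (∀ d ∈ D, pd 1 Q.τ d = 0) →
      (∀ d ∈ D, pd 0 Q.τ d = 2 * pd 1 Q.ξ d) → ContDiffOn ℝ ∞ Q.ξ D →
      ∀ d ∈ D, pd 1 (pd 1 Q.ξ) d = 0 := by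
    intro hτ h1 h2 hξ d hd
    have e := hasPd_of_contDiffOn hD (contDiffOn_pd hD hξ 1) hd 1
    have e' := (hasPd_of_contDiffOn hD (contDiffOn_pd hD hτ 0) hd 1).congr_of_eqOn hD hd
      (g := fun d => pd 1 Q.ξ d + pd 1 Q.ξ d) (fun d hd => by simp only [h2 d hd]; ring)
    have := (e.add e).unique e'
    rw [pd_comm hD hτ hd, zero _ 0 h1 d hd] at this
    linarith
  constructor
  · rintro ⟨hτ, hξ, hθ, hinv⟩
    have hc := (eq_invariant_iff Q h0 hα hα₁).1 hinv
    refine ⟨⟨hτ, hξ, hθ⟩, ?_⟩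
    -- the coefficient of `v_tx`
    have hτ₁ : ∀ d ∈ D, pd 1 Q.τ d = 0 := fun d hd => by
      have e1 := hc d hd 0 0 1
      have e0 := hc d hd 0 0 0
      simp only [eqCrit] at e1 e0
      linarith
    have hτ₂ : ∀ d ∈ D, pd 2 Q.τ d = 0 := fun d hd => by
      have e1 := hc d hd 0 1 1
      have e0 := hc d hd 0 1 0
      simp only [eqCrit, hτ₁ d hd] at e1 e0
      linarith
    have hred : ∀ d ∈ D, ∀ a b, eqCrit α Q d a b 0 = 0 := fun d hd a b => hc d hd a b 0
    -- the coefficient of `v_t v_x`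
    have hξ₂ : ∀ d ∈ D, pd 2 Q.ξ d = 0 := fun d hd => by
      have e1 := hred d hd 1 1
      have e2 := hred d hd 1 0
      have e3 := hred d hd 0 1
      have e4 := hred d hd 0 0
      simp only [eqCrit, hτ₁ d hd, hτ₂ d hd, zero _ 1 hτ₁ d hd, zero _ 1 hτ₂ d hd,
        zero _ 2 hτ₂ d hd] at e1 e2 e3 e4
      linarith
    -- the coefficient of `v_t`
    have hτ₀ : ∀ d ∈ D, pd 0 Q.τ d = 2 * pd 1 Q.ξ d := fun d hd => by
      have e1 := hred d hd 1 0
      have e2 := hred d hd 0 0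
      simp only [eqCrit, hτ₁ d hd, hτ₂ d hd, zero _ 1 hτ₁ d hd, zero _ 1 hτ₂ d hd,
        zero _ 2 hτ₂ d hd, hξ₂ d hd] at e1 e2
      linarith
    -- what is left is quadratic in `v_x`
    intro d hd
    have e0 := hred d hd 0 0
    have e1 := hred d hd 0 1
    have e2 := hred d hd 0 (-1)
    simp only [eqCrit, hτ₁ d hd, hτ₂ d hd, zero _ 1 hτ₁ d hd, zero _ 1 hτ₂ d hd,
        zero _ 2 hτ₂ d hd, hξ₂ d hd, zero _ 1 hξ₂ d hd, zero _ 2 hξ₂ d hd,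
        ξxx hτ hτ₁ hτ₀ hξ d hd] at e0 e1 e2
    have hA := h0 d hd
    refine ⟨hτ₁ d hd, hτ₂ d hd, hξ₂ d hd, by linarith, hτ₀ d hd, ?_, ?_⟩
    · field_simp at e1 e2
      linarith
    · field_simp at e0
      apply mul_left_cancel₀ hA
      linear_combination e0
  · rintro ⟨⟨hτ, hξ, hθ⟩, hdet⟩
    refine ⟨hτ, hξ, hθ, (eq_invariant_iff Q h0 hα hα₁).2 fun d hd a b c => ?_⟩
    have hA := h0 d hd
    obtain ⟨h1, h2, h3, h4, h5, h6, h7⟩ := hdet d hd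
    have hτ₂ := fun d hd => (hdet d hd).τ_v
    have hξ₂ := fun d hd => (hdet d hd).ξ_v
    simp only [eqCrit, h1, h2, h3, h4, h5, zero _ 1 (fun d hd => (hdet d hd).τ_x) d hd,
      zero _ 1 hτ₂ d hd, zero _ 2 hτ₂ d hd, zero _ 1 hξ₂ d hd, zero _ 2 hξ₂ d hd,
      ξxx hτ (fun d hd => (hdet d hd).τ_x) (fun d hd => (hdet d hd).τ_t) hξ d hd]
    field_simp
    linear_combination α (tx d) * h7 - b * h6

/-! ### Functions that do not depend on `u` -/

/-- `f` is smooth on `M` and its partial derivative with respect to `u` vanishes there. -/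
structure UFree (M : Set (Fin 4 → ℝ)) (f : (Fin 4 → ℝ) → ℝ) : Prop where
  smooth : ContDiffOn ℝ ∞ f M
  pd_two : ∀ p ∈ M, pd 2 f p = 0

section UFree

variable {M : Set (Fin 4 → ℝ)} {f g : (Fin 4 → ℝ) → ℝ}

theorem UFree.hasPd (hf : UFree M f) (hM : IsOpen M) {p : Fin 4 → ℝ} (hp : p ∈ M) :
    HasPd 2 f 0 p := by
  rw [← hf.pd_two p hp]
  exact hasPd_of_contDiffOn hM hf.smooth hp 2

theorem uFree_of_hasPd (hM : IsOpen M) (hf : ContDiffOn ℝ ∞ f M)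
    (h : ∀ p ∈ M, HasPd 2 f 0 p) : UFree M f :=
  ⟨hf, fun p hp => (h p hp).pd_eq (differentiableAt_of_contDiffOn hM hf hp)⟩

theorem UFree.add (hM : IsOpen M) (hf : UFree M f) (hg : UFree M g) :
    UFree M fun p => f p + g p :=
  uFree_of_hasPd hM (hf.smooth.add hg.smooth) fun _ hp => by
    simpa using (hf.hasPd hM hp).add (hg.hasPd hM hp)

theorem UFree.sub (hM : IsOpen M) (hf : UFree M f) (hg : UFree M g) :
    UFree M fun p => f p - g p :=
  uFree_of_hasPd hM (hf.smooth.sub hg.smooth) fun _ hp => by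
    simpa using (hf.hasPd hM hp).sub (hg.hasPd hM hp)

theorem UFree.mul (hM : IsOpen M) (hf : UFree M f) (hg : UFree M g) :
    UFree M fun p => f p * g p :=
  uFree_of_hasPd hM (hf.smooth.mul hg.smooth) fun _ hp => by
    simpa using (hf.hasPd hM hp).mul (hg.hasPd hM hp)

theorem uFree_const (M : Set (Fin 4 → ℝ)) (c : ℝ) : UFree M fun _ => c :=
  ⟨contDiffOn_const, fun p _ => by simp [pd]⟩

theorem UFree.pd (hM : IsOpen M) (hf : UFree M f) (i : Fin 4) : UFree M (pd i f) :=
  ⟨contDiffOn_pd hM hf.smooth i, fun p hp => by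
    rw [pd_comm hM hf.smooth hp, pd_eq_zero_of_eqOn hM hp hf.pd_two]⟩

/-- A polynomial in `u` whose coefficients do not depend on `u` vanishes on an open set only if all
coefficients vanish there. -/
theorem coeff_eq_zero_of_quadratic (hM : IsOpen M) {c₀ c₁ c₂ : (Fin 4 → ℝ) → ℝ}
    (h₀ : UFree M c₀) (h₁ : UFree M c₁) (h₂ : UFree M c₂)
    (h : ∀ p ∈ M, c₀ p + p 2 * c₁ p + p 2 * p 2 * c₂ p = 0) :
    ∀ p ∈ M, c₀ p = 0 ∧ c₁ p = 0 ∧ c₂ p = 0 := by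
  have hz : ∀ p, HasPd 2 (fun _ : Fin 4 → ℝ => (0 : ℝ)) 0 p := fun p => by
    simpa [pd] using
      hasPd_pd (f := fun _ : Fin 4 → ℝ => (0 : ℝ)) (differentiableAt_const _) (p := p) 2
  have hu := fun p : Fin 4 → ℝ => hasPd_coord_self 2 p
  have d₁ : ∀ p ∈ M, c₁ p + 2 * p 2 * c₂ p = 0 := fun p hp => by
    have := (((h₀.hasPd hM hp).add ((hu p).mul (h₁.hasPd hM hp))).add
      (((hu p).mul (hu p)).mul (h₂.hasPd hM hp))).unique ((hz p).congr_of_eqOn hM hp h)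
    linarith
  have d₂ : ∀ p ∈ M, c₂ p = 0 := fun p hp => by
    have := ((h₁.hasPd hM hp).add (((hu p).add (hu p)).mul (h₂.hasPd hM hp))).unique
      ((hz p).congr_of_eqOn hM hp fun q hq => by
        have := d₁ q hq
        linarith)
    linarith
  intro p hp
  have e₁ := d₁ p hp
  have e₀ := h p hp
  rw [d₂ p hp] at e₁ e₀
  have : c₁ p = 0 := by linarith
  rw [this] at e₀
  exact ⟨by linarith, this, d₂ p hp⟩

end UFree

/-! ### The determining equations of the potential system -/

/-- The determining equations of the Lie symmetry operators of the potential system, at a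
point; the last three are multiplied by powers of `α` to clear denominators. -/
structure SysDet (α : (Fin 2 → ℝ) → ℝ) (Q : SysField) (p : Fin 4 → ℝ) : Prop where
  τ_u : pd 2 Q.τ p = 0
  ξ_u : pd 2 Q.ξ p = 0
  θ_u : pd 2 Q.θ p = 0
  τ_x : pd 1 Q.τ p = 0
  τ_v : pd 3 Q.τ p = 0
  ξ_v : pd 3 Q.ξ p = 0
  θ_vv : pd 3 (pd 3 Q.θ) p = 0
  τ_t : pd 0 Q.τ p = 2 * pd 1 Q.ξ p
  θ_xv : 2 * α (tx p) ^ 2 * pd 1 (pd 3 Q.θ) p =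
    -α (tx p) ^ 2 * pd 0 Q.ξ p
      + 2 * (pd 0 (pd 1 α) (tx p) * α (tx p) - pd 1 α (tx p) * pd 0 α (tx p)) * Q.τ p
      + 2 * (pd 1 (pd 1 α) (tx p) * α (tx p) - pd 1 α (tx p) ^ 2) * Q.ξ p
      + 2 * pd 1 α (tx p) * α (tx p) * pd 1 Q.ξ p
  θ_t : α (tx p) * (pd 0 Q.θ p - pd 1 (pd 1 Q.θ) p) + 2 * pd 1 α (tx p) * pd 1 Q.θ p = 0
  η_eq : α (tx p) * Q.η p = p 2 * (α (tx p) * (pd 3 Q.θ p - pd 1 Q.ξ p)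
    - pd 0 α (tx p) * Q.τ p - pd 1 α (tx p) * Q.ξ p) + pd 1 Q.θ p

section SysDet

variable {Ω : Set (Fin 2 → ℝ)} {α : (Fin 2 → ℝ) → ℝ} {M : Set (Fin 4 → ℝ)}

theorem hasPd_comp_tx (hΩ : IsOpen Ω) (hα : ContDiffOn ℝ ∞ α Ω) {p : Fin 4 → ℝ}
    (hp : tx p ∈ Ω) :
    HasPd 1 (fun q : Fin 4 → ℝ => α (tx q)) (pd 1 α (tx p)) p ∧
    HasPd 2 (fun q : Fin 4 → ℝ => α (tx q)) 0 p ∧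
    HasPd 3 (fun q : Fin 4 → ℝ => α (tx q)) 0 p := by
  have hd := differentiableAt_of_contDiffOn hΩ hα hp
  have hd' : DifferentiableAt ℝ (fun q : Fin 4 → ℝ => α (tx q)) p :=
    hd.comp p (contDiff_tx.contDiffAt.differentiableAt (by simp))
  obtain ⟨-, h1, h2, h3⟩ := pd_tx hd
  exact ⟨h1 ▸ hasPd_pd hd' 1, h2 ▸ hasPd_pd hd' 2, h3 ▸ hasPd_pd hd' 3⟩

theorem uFree_comp_tx (hΩ : IsOpen Ω) (hα : ContDiffOn ℝ ∞ α Ω) (hM : IsOpen M)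
    (hMΩ : ∀ p ∈ M, tx p ∈ Ω) : UFree M fun p => α (tx p) :=
  uFree_of_hasPd hM (hα.comp contDiff_tx.contDiffOn hMΩ) fun _ hp =>
    (hasPd_comp_tx hΩ hα (hMΩ _ hp)).2.1

/-- If `τ_x = τ_v = ξ_v = 0` and `α η` has the form required by `v_x = α u`, the first derivatives
of `η` are determined. -/
theorem pd_η (hΩ : IsOpen Ω) (hα : ContDiffOn ℝ ∞ α Ω) (hM : IsOpen M)
    (hMΩ : ∀ p ∈ M, tx p ∈ Ω) {Q : SysField}
    (hτ : UFree M Q.τ) (hξ : UFree M Q.ξ) (hθ : UFree M Q.θ) (hη : ContDiffOn ℝ ∞ Q.η M)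
    (τ_x : ∀ p ∈ M, pd 1 Q.τ p = 0) (τ_v : ∀ p ∈ M, pd 3 Q.τ p = 0)
    (ξ_v : ∀ p ∈ M, pd 3 Q.ξ p = 0)
    (η_eq : ∀ p ∈ M, α (tx p) * Q.η p = p 2 * (α (tx p) * (pd 3 Q.θ p - pd 1 Q.ξ p)
      - pd 0 α (tx p) * Q.τ p - pd 1 α (tx p) * Q.ξ p) + pd 1 Q.θ p)
    {p : Fin 4 → ℝ} (hp : p ∈ M) :
    (α (tx p) * pd 2 Q.η p = α (tx p) * (pd 3 Q.θ p - pd 1 Q.ξ p)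
      - pd 0 α (tx p) * Q.τ p - pd 1 α (tx p) * Q.ξ p) ∧
    (α (tx p) * pd 3 Q.η p = p 2 * (α (tx p) * pd 3 (pd 3 Q.θ) p) + pd 1 (pd 3 Q.θ) p) ∧
    (pd 1 α (tx p) * Q.η p + α (tx p) * pd 1 Q.η p =
      p 2 * (pd 1 α (tx p) * (pd 3 Q.θ p - pd 1 Q.ξ p)
        + α (tx p) * (pd 1 (pd 3 Q.θ) p - pd 1 (pd 1 Q.ξ) p)
        - pd 0 (pd 1 α) (tx p) * Q.τ p - pd 1 (pd 1 α) (tx p) * Q.ξ p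
        - pd 1 α (tx p) * pd 1 Q.ξ p) + pd 1 (pd 1 Q.θ) p) := by
  have hΩp := hMΩ p hp
  obtain ⟨A1, A2, A3⟩ := hasPd_comp_tx hΩ hα hΩp
  obtain ⟨At1, At2, At3⟩ := hasPd_comp_tx hΩ (contDiffOn_pd hΩ hα 0) hΩp
  obtain ⟨Ax1, Ax2, Ax3⟩ := hasPd_comp_tx hΩ (contDiffOn_pd hΩ hα 1) hΩp
  have d := fun {f : (Fin 4 → ℝ) → ℝ} (hf : ContDiffOn ℝ ∞ f M) (i : Fin 4) =>
    hasPd_of_contDiffOn hM hf hp i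
  have cθv := contDiffOn_pd hM hθ.smooth 3
  have cθx := contDiffOn_pd hM hθ.smooth 1
  have cξx := contDiffOn_pd hM hξ.smooth 1
  -- both sides of the formula for `α η` have the same partial derivatives
  have e : Set.EqOn (fun p => p 2 * (α (tx p) * (pd 3 Q.θ p - pd 1 Q.ξ p)
      - pd 0 α (tx p) * Q.τ p - pd 1 α (tx p) * Q.ξ p) + pd 1 Q.θ p)
      (fun p => α (tx p) * Q.η p) M := fun q hq => (η_eq q hq).symm
  have k : ∀ {i : Fin 4} {a aₜ aₓ u' : ℝ}, HasPd i (fun q : Fin 4 → ℝ => α (tx q)) a p →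
      HasPd i (fun q : Fin 4 → ℝ => pd 0 α (tx q)) aₜ p →
      HasPd i (fun q : Fin 4 → ℝ => pd 1 α (tx q)) aₓ p →
      HasPd i (fun q : Fin 4 → ℝ => q 2) u' p → _ := fun {i} {a aₜ aₓ u'} hA hAt hAx hu =>
    ((hu.mul (((hA.mul ((d cθv i).sub (d cξx i))).sub (hAt.mul (d hτ.smooth i))).sub
      (hAx.mul (d hξ.smooth i)))).add (d cθx i)).unique
      ((hA.mul (d hη i)).congr_of_eqOn hM hp e)
  have k2 := k A2 At2 Ax2 (hasPd_coord_self 2 p)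
  have k3 := k A3 At3 Ax3 (hasPd_coord_of_ne (by decide) p)
  have k1 := k A1 At1 Ax1 (hasPd_coord_of_ne (by decide) p)
  have ξxv : pd 3 (pd 1 Q.ξ) p = 0 := by
    rw [pd_comm hM hξ.smooth hp, pd_eq_zero_of_eqOn hM hp ξ_v]
  rw [hτ.pd_two p hp, hξ.pd_two p hp, (hξ.pd hM 1).pd_two p hp, (hθ.pd hM 3).pd_two p hp,
    (hθ.pd hM 1).pd_two p hp] at k2
  rw [τ_v p hp, ξ_v p hp, ξxv, pd_comm hM hθ.smooth hp 3 1] at k3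
  rw [τ_x p hp, pd_comm hΩ hα hΩp 1 0] at k1
  exact ⟨by linarith, by linarith, by linarith⟩

/-- The invariance criterion of the potential system, a polynomial in `u_t`, `u_x` and, after `τ`,
`ξ`, `θ` have been seen not to depend on `u`, also in `u`, splits into the determining equations. -/
theorem isSysSymmetry_iff (hΩ : IsOpen Ω) (hα : ContDiffOn ℝ ∞ α Ω) (hM : IsOpen M)
    (hMα : ∀ p ∈ M, tx p ∈ Ω ∧ α (tx p) ≠ 0) (Q : SysField) :
    IsSysSymmetry α M Q ↔ (ContDiffOn ℝ ∞ Q.τ M ∧ ContDiffOn ℝ ∞ Q.ξ M ∧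
      ContDiffOn ℝ ∞ Q.η M ∧ ContDiffOn ℝ ∞ Q.θ M) ∧ ∀ p ∈ M, SysDet α Q p := by
  have hMΩ := fun p hp => (hMα p hp).1
  have hα₁ := contDiffOn_pd hΩ hα 1
  have hiff := sys_invariant_iff (M := M) Q
    (fun p hp => differentiableAt_of_contDiffOn hΩ hα (hMΩ p hp))
    (fun p hp => differentiableAt_of_contDiffOn hΩ hα₁ (hMΩ p hp))
  -- `2 ξ_xx = τ_tx = 0`
  have ξxx : ContDiffOn ℝ ∞ Q.τ M → (∀ p ∈ M, pd 1 Q.τ p = 0) →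
      (∀ p ∈ M, pd 0 Q.τ p = 2 * pd 1 Q.ξ p) → ContDiffOn ℝ ∞ Q.ξ M →
      ∀ p ∈ M, pd 1 (pd 1 Q.ξ) p = 0 := by
    intro hτ h1 h2 hξ p hp
    have e := hasPd_of_contDiffOn hM (contDiffOn_pd hM hξ 1) hp 1
    have e' := (hasPd_of_contDiffOn hM (contDiffOn_pd hM hτ 0) hp 1).congr_of_eqOn hM hp
      (g := fun p => pd 1 Q.ξ p + pd 1 Q.ξ p) (fun p hp => by simp only [h2 p hp]; ring)
    have := (e.add e).unique e'
    rw [pd_comm hM hτ hp, pd_eq_zero_of_eqOn hM hp h1 0] at this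
    linarith
  have A := uFree_comp_tx hΩ hα hM hMΩ
  have At := uFree_comp_tx hΩ (contDiffOn_pd hΩ hα 0) hM hMΩ
  have Ax := uFree_comp_tx hΩ hα₁ hM hMΩ
  have Atx := uFree_comp_tx hΩ (contDiffOn_pd hΩ hα₁ 0) hM hMΩ
  have Axx := uFree_comp_tx hΩ (contDiffOn_pd hΩ hα₁ 1) hM hMΩ
  constructor
  · rintro ⟨cτ, cξ, cη, cθ, hinv⟩
    have hc := hiff.1 hinv
    refine ⟨⟨cτ, cξ, cη, cθ⟩, ?_⟩
    -- the coefficient of `u_x ^ 2` in the first criterion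
    have τ_u : ∀ p ∈ M, pd 2 Q.τ p = 0 := fun p hp => by
      have e0 := (hc p hp 0 0).1
      have e1 := (hc p hp 0 1).1
      have e2 := (hc p hp 0 (-1)).1
      simp only [sysCrit₁] at e0 e1 e2
      apply mul_left_cancel₀ (hMα p hp).2
      linarith
    -- the coefficient of `u_x` in the first criterion
    have c1 : ∀ p ∈ M, pd 2 Q.θ p = α (tx p) * (pd 1 Q.τ p + α (tx p) * p 2 * pd 3 Q.τ p)
        + α (tx p) * p 2 * pd 2 Q.ξ p := fun p hp => by
      have e0 := (hc p hp 0 0).1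
      have e1 := (hc p hp 0 1).1
      simp only [sysCrit₁, τ_u p hp] at e0 e1
      linarith
    -- the coefficient of `u_t` in the second criterion
    have c2 : ∀ p ∈ M, pd 2 Q.θ p = α (tx p) * p 2 * pd 2 Q.ξ p
        - α (tx p) * (pd 1 Q.τ p + α (tx p) * p 2 * pd 3 Q.τ p) := fun p hp => by
      have e0 := (hc p hp 0 0).2
      have e1 := (hc p hp 1 0).2
      simp only [sysCrit₂, τ_u p hp] at e0 e1
      linarith
    have uτ : UFree M Q.τ := ⟨cτ, τ_u⟩
    have τxv := coeff_eq_zero_of_quadratic hM (uτ.pd hM 1) (A.mul hM (uτ.pd hM 3))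
      (uFree_const M 0) fun p hp => by
        apply mul_left_cancel₀ (hMα p hp).2
        linarith [c1 p hp, c2 p hp]
    have τ_x : ∀ p ∈ M, pd 1 Q.τ p = 0 := fun p hp => (τxv p hp).1
    have τ_v : ∀ p ∈ M, pd 3 Q.τ p = 0 := fun p hp =>
      (mul_eq_zero.1 (τxv p hp).2.1).resolve_left (hMα p hp).2
    -- the coefficient of `u_x ^ 2` in the second criterion
    have ξ_u : ∀ p ∈ M, pd 2 Q.ξ p = 0 := fun p hp => by
      have e0 := (hc p hp 0 0).2
      have e1 := (hc p hp 0 1).2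
      have e2 := (hc p hp 0 (-1)).2
      simp only [sysCrit₂, τ_u p hp, τ_v p hp, τ_x p hp] at e0 e1 e2
      apply mul_left_cancel₀ (hMα p hp).2
      linarith
    have θ_u : ∀ p ∈ M, pd 2 Q.θ p = 0 := fun p hp => by
      simpa [ξ_u p hp, τ_x p hp, τ_v p hp] using c1 p hp
    have uξ : UFree M Q.ξ := ⟨cξ, ξ_u⟩
    have uθ : UFree M Q.θ := ⟨cθ, θ_u⟩
    -- what is left of the first criterion
    have η₀ : ∀ p ∈ M, p 2 * (α (tx p) * (pd 3 Q.θ p - pd 1 Q.ξ p)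
        - pd 0 α (tx p) * Q.τ p - pd 1 α (tx p) * Q.ξ p) + pd 1 Q.θ p
        - (p 2 * p 2) * (α (tx p) * α (tx p) * pd 3 Q.ξ p) = α (tx p) * Q.η p := fun p hp => by
      have e0 := (hc p hp 0 0).1
      simp only [sysCrit₁, τ_u p hp, τ_v p hp, τ_x p hp, ξ_u p hp, θ_u p hp] at e0
      linarith
    have η_u : ∀ p ∈ M, α (tx p) * pd 2 Q.η p = α (tx p) * (pd 3 Q.θ p - pd 1 Q.ξ p)
        - pd 0 α (tx p) * Q.τ p - pd 1 α (tx p) * Q.ξ p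
        - 2 * p 2 * (α (tx p) * α (tx p) * pd 3 Q.ξ p) := fun p hp => by
      have hu := hasPd_coord_self 2 p
      have B := (((A.mul hM ((uθ.pd hM 3).sub hM (uξ.pd hM 1))).sub hM (At.mul hM uτ)).sub hM
        (Ax.mul hM uξ)).hasPd hM hp
      have C := ((A.mul hM A).mul hM (uξ.pd hM 3)).hasPd hM hp
      have := (((hu.mul B).add ((uθ.pd hM 1).hasPd hM hp)).sub ((hu.mul hu).mul C)).unique
        (((A.hasPd hM hp).mul (hasPd_of_contDiffOn hM cη hp 2)).congr_of_eqOn hM hp η₀)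
      linarith
    -- the coefficient of `u_x` in the second criterion
    have ξτ := coeff_eq_zero_of_quadratic hM
      (((uFree_const M 2).mul hM (uξ.pd hM 1)).sub hM (uτ.pd hM 0))
      (((uFree_const M 2).mul hM A).mul hM (uξ.pd hM 3)) (uFree_const M 0) fun p hp => by
        have e0 := (hc p hp 0 0).2
        have e1 := (hc p hp 0 1).2
        simp only [sysCrit₂, τ_u p hp, τ_v p hp, τ_x p hp, ξ_u p hp, θ_u p hp] at e0 e1
        have := η_u p hp
        apply mul_left_cancel₀ (hMα p hp).2
        linarith
    have ξ_v : ∀ p ∈ M, pd 3 Q.ξ p = 0 := fun p hp =>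
      (mul_eq_zero.1 (ξτ p hp).2.1).resolve_left (mul_ne_zero two_ne_zero (hMα p hp).2)
    have τ_t : ∀ p ∈ M, pd 0 Q.τ p = 2 * pd 1 Q.ξ p := fun p hp => by linarith [(ξτ p hp).1]
    have η_eq : ∀ p ∈ M, α (tx p) * Q.η p = p 2 * (α (tx p) * (pd 3 Q.θ p - pd 1 Q.ξ p)
        - pd 0 α (tx p) * Q.τ p - pd 1 α (tx p) * Q.ξ p) + pd 1 Q.θ p := fun p hp => by
      rw [← η₀ p hp, ξ_v p hp]; ring
    -- what is left of the second criterion is quadratic in `u`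
    have last := coeff_eq_zero_of_quadratic hM
      (c₀ := fun p => α (tx p) * (pd 0 Q.θ p - pd 1 (pd 1 Q.θ) p)
        + 2 * pd 1 α (tx p) * pd 1 Q.θ p)
      (c₁ := fun p => α (tx p) * α (tx p) * (0 - pd 0 Q.ξ p)
        + 2 * (pd 0 (pd 1 α) (tx p) * α (tx p) - pd 1 α (tx p) * pd 0 α (tx p)) * Q.τ p
        + 2 * (pd 1 (pd 1 α) (tx p) * α (tx p) - pd 1 α (tx p) * pd 1 α (tx p)) * Q.ξ p
        + 2 * pd 1 α (tx p) * α (tx p) * pd 1 Q.ξ p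
        - 2 * (α (tx p) * α (tx p)) * pd 1 (pd 3 Q.θ) p)
      (c₂ := fun p => α (tx p) * α (tx p) * α (tx p) * (0 - pd 3 (pd 3 Q.θ) p))
      ((A.mul hM ((uθ.pd hM 0).sub hM ((uθ.pd hM 1).pd hM 1))).add hM
        (((uFree_const M 2).mul hM Ax).mul hM (uθ.pd hM 1)))
      ((((((A.mul hM A).mul hM ((uFree_const M 0).sub hM (uξ.pd hM 0))).add hM
        (((uFree_const M 2).mul hM ((Atx.mul hM A).sub hM (Ax.mul hM At))).mul hM uτ)).add hM
        (((uFree_const M 2).mul hM ((Axx.mul hM A).sub hM (Ax.mul hM Ax))).mul hM uξ)).add hM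
        ((((uFree_const M 2).mul hM Ax).mul hM A).mul hM (uξ.pd hM 1))).sub hM
        (((uFree_const M 2).mul hM (A.mul hM A)).mul hM ((uθ.pd hM 3).pd hM 1)))
      (((A.mul hM A).mul hM A).mul hM ((uFree_const M 0).sub hM ((uθ.pd hM 3).pd hM 3)))
      fun p hp => by
        have e0 := (hc p hp 0 0).2
        simp only [sysCrit₂, τ_u p hp, τ_v p hp, τ_x p hp, ξ_u p hp, θ_u p hp, ξ_v p hp,
          τ_t p hp] at e0
        obtain ⟨-, η_v, η_x⟩ := pd_η hΩ hα hM hMΩ uτ uξ uθ cη τ_x τ_v ξ_v η_eq hp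
        rw [ξxx cτ τ_x τ_t cξ p hp] at η_x
        linear_combination α (tx p) * e0 + α (tx p) * η_x + α (tx p) * α (tx p) * p 2 * η_v
          - 2 * pd 1 α (tx p) * η_eq p hp
    intro p hp
    obtain ⟨l0, l1, l2⟩ := last p hp
    have hA := (hMα p hp).2
    refine ⟨τ_u p hp, ξ_u p hp, θ_u p hp, τ_x p hp, τ_v p hp, ξ_v p hp, ?_, τ_t p hp,
      by linarith, l0, η_eq p hp⟩
    have := (mul_eq_zero.1 l2).resolve_left (mul_ne_zero (mul_ne_zero hA hA) hA)
    linarith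
  · rintro ⟨⟨cτ, cξ, cη, cθ⟩, hdet⟩
    refine ⟨cτ, cξ, cη, cθ, hiff.2 fun p hp a q => ?_⟩
    obtain ⟨η_u, η_v, η_x⟩ := pd_η hΩ hα hM hMΩ ⟨cτ, fun p hp => (hdet p hp).τ_u⟩
      ⟨cξ, fun p hp => (hdet p hp).ξ_u⟩ ⟨cθ, fun p hp => (hdet p hp).θ_u⟩ cη
      (fun p hp => (hdet p hp).τ_x) (fun p hp => (hdet p hp).τ_v) (fun p hp => (hdet p hp).ξ_v)
      (fun p hp => (hdet p hp).η_eq) hp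
    rw [ξxx cτ (fun p hp => (hdet p hp).τ_x) (fun p hp => (hdet p hp).τ_t) cξ p hp] at η_x
    obtain ⟨h1, h2, h3, h4, h5, h6, h7, h8, h9, h10, h11⟩ := hdet p hp
    rw [h7] at η_v
    constructor
    · simp only [sysCrit₁, h1, h2, h3, h4, h5, h6]
      linarith
    · simp only [sysCrit₂, h1, h2, h3, h4, h5, h6, h8]
      apply mul_left_cancel₀ (hMα p hp).2
      linear_combination h10 - p 2 * h9 - α (tx p) * η_x - α (tx p) * α (tx p) * p 2 * η_v
        - α (tx p) * q * η_u + 2 * pd 1 α (tx p) * h11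

end SysDet

/-! ### Descent to the space of `(t, x, v)` -/

/-- The point of `(t, x, u, v)`-space above `d` with `u`-coordinate `u`. -/
def insU (u : ℝ) (d : Fin 3 → ℝ) : Fin 4 → ℝ := ![d 0, d 1, u, d 2]

theorem dropU_insU (u : ℝ) (d : Fin 3 → ℝ) : dropU (insU u d) = d := by
  ext i; fin_cases i <;> rfl

theorem insU_dropU (p : Fin 4 → ℝ) : insU (p 2) (dropU p) = p := by
  ext i; fin_cases i <;> rfl

theorem contDiff_insU (u : ℝ) : ContDiff ℝ ∞ (insU u) := by
  rw [contDiff_pi]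
  intro i
  fin_cases i
  · exact contDiff_apply ℝ ℝ (0 : Fin 3)
  · exact contDiff_apply ℝ ℝ (1 : Fin 3)
  · exact contDiff_const
  · exact contDiff_apply ℝ ℝ (2 : Fin 3)

section Descent

variable {M : Set (Fin 4 → ℝ)} {f : (Fin 4 → ℝ) → ℝ} {g : (Fin 3 → ℝ) → ℝ}

theorem isOpen_image_dropU (hM : IsOpen M) : IsOpen (dropU '' M) := by
  rw [isOpen_iff_mem_nhds]
  rintro _ ⟨p, hp, rfl⟩
  have h : insU (p 2) ⁻¹' M ∈ nhds (dropU p) :=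
    (contDiff_insU (p 2)).continuous.continuousAt.preimage_mem_nhds
      (hM.mem_nhds (by rwa [insU_dropU]))
  exact Filter.mem_of_superset h fun d hd => ⟨_, hd, dropU_insU _ _⟩

/-- A function without `u`-derivative is constant along the fibres of `dropU` in `M`, because these
are intervals. -/
theorem UFree.eq_of_dropU_eq (hM : IsOpen M)
    (hMu : ∀ t x v : ℝ, Set.OrdConnected {u : ℝ | ![t, x, u, v] ∈ M}) (hf : UFree M f)
    {p q : Fin 4 → ℝ} (hp : p ∈ M) (hq : q ∈ M) (hpq : dropU p = dropU q) : f p = f q := by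
  have hline : ∀ u s : ℝ, insU u (dropU p) + s • Pi.single 2 1 = insU (u + s) (dropU p) := by
    intro u s; ext i; fin_cases i <;> simp [insU]
  have hcont : Continuous fun u : ℝ => insU u (dropU p) :=
    continuous_pi fun i => by fin_cases i <;> simp [insU] <;> fun_prop
  have hS : IsOpen {u : ℝ | insU u (dropU p) ∈ M} := hM.preimage hcont
  have hder : ∀ u ∈ {u : ℝ | insU u (dropU p) ∈ M},
      HasDerivAt (fun u => f (insU u (dropU p))) 0 u := by
    intro u hu
    have h : HasDerivAt (fun s : ℝ => f (insU (u + s) (dropU p))) 0 0 := by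
      simpa only [HasPd, HasLineDerivAt, hline] using hf.hasPd hM hu
    have h' := HasDerivAt.comp_sub_const u u (by rwa [sub_self])
    simpa using h'
  have := hS.is_const_of_deriv_eq_zero (hMu _ _ _).isPreconnected
    (fun u hu => (hder u hu).differentiableAt.differentiableWithinAt)
    (fun u hu => (hder u hu).deriv) (x := p 2) (y := q 2)
    (by rwa [Set.mem_ofPred, insU_dropU]) (by rwa [Set.mem_ofPred, hpq, insU_dropU])
  rwa [insU_dropU, hpq, insU_dropU] at this

theorem UFree.truncFun_dropU (hM : IsOpen M)
    (hMu : ∀ t x v : ℝ, Set.OrdConnected {u : ℝ | ![t, x, u, v] ∈ M}) (hf : UFree M f)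
    {p : Fin 4 → ℝ} (hp : p ∈ M) : truncFun M f (dropU p) = f p := by
  have h : Function.FactorsThrough (fun p : M => f p) (fun p : M => dropU p) :=
    fun a b hab => hf.eq_of_dropU_eq hM hMu a.2 b.2 hab
  exact h.extend_apply 0 ⟨p, hp⟩

theorem truncFun_of_notMem {d : Fin 3 → ℝ} (hd : d ∉ dropU '' M) : truncFun M f d = 0 :=
  Function.extend_apply' _ _ _ fun ⟨p, hp⟩ => hd ⟨p, p.2, hp⟩

theorem truncFun_dropU_of_eqOn (hfg : ∀ p ∈ M, f p = g (dropU p)) {d : Fin 3 → ℝ}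
    (hd : d ∈ dropU '' M) : truncFun M f d = g d := by
  obtain ⟨p, hp, rfl⟩ := hd
  have h : Function.FactorsThrough (fun p : M => f p) (fun p : M => dropU p) :=
    fun a b hab => by
      simp only [hfg a a.2, hfg b b.2]
      exact congrArg g hab
  exact (h.extend_apply 0 ⟨p, hp⟩).trans (hfg p hp)

/-- Near `dropU p` the induced function is `f` on the section of `dropU` through `p` with
constant `u`. -/
theorem UFree.contDiffOn_truncFun (hM : IsOpen M)
    (hMu : ∀ t x v : ℝ, Set.OrdConnected {u : ℝ | ![t, x, u, v] ∈ M}) (hf : UFree M f) :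
    ContDiffOn ℝ ∞ (truncFun M f) (dropU '' M) := by
  rintro _ ⟨p, hp, rfl⟩
  have hp' : insU (p 2) (dropU p) ∈ M := by rwa [insU_dropU]
  have hev : ∀ᶠ d in nhds (dropU p), insU (p 2) d ∈ M :=
    (contDiff_insU (p 2)).continuous.continuousAt.preimage_mem_nhds (hM.mem_nhds hp')
  have hc : ContDiffAt ℝ ∞ (fun d => f (insU (p 2) d)) (dropU p) :=
    ((hf.smooth _ hp').contDiffAt (hM.mem_nhds hp')).comp _ (contDiff_insU (p 2)).contDiffAt
  refine (hc.congr_of_eventuallyEq ?_).contDiffWithinAt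
  filter_upwards [hev] with d hd
  rw [← hf.truncFun_dropU hM hMu hd, dropU_insU]

theorem pd_of_eq_comp_dropU (hM : IsOpen M) (hg : ContDiffOn ℝ ∞ g (dropU '' M))
    (hfg : ∀ p ∈ M, f p = g (dropU p)) {p : Fin 4 → ℝ} (hp : p ∈ M) :
    pd 0 f p = pd 0 g (dropU p) ∧ pd 1 f p = pd 1 g (dropU p) ∧ pd 2 f p = 0 ∧
      pd 3 f p = pd 2 g (dropU p) := by
  have h := pd_dropU (differentiableAt_of_contDiffOn (isOpen_image_dropU hM) hg ⟨p, hp, rfl⟩)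
  simp only [pd_congr (g := fun p => g (dropU p)) hM hp hfg]
  exact h

theorem contDiffOn_of_eq_comp_dropU (hg : ContDiffOn ℝ ∞ g (dropU '' M))
    (hfg : ∀ p ∈ M, f p = g (dropU p)) : ContDiffOn ℝ ∞ f M :=
  (hg.comp contDiff_dropU.contDiffOn fun p hp => ⟨p, hp, rfl⟩).congr hfg

/-- If the coefficients `τ`, `ξ`, `θ` come from `(t, x, v)`-space, the determining equations of the
potential system are those of the potential equation and the formula for `η`. -/
theorem sysDet_iff_eqDet (hM : IsOpen M) {α : (Fin 2 → ℝ) → ℝ} {Q : SysField} {R : EqField}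
    (hτ : ContDiffOn ℝ ∞ R.τ (dropU '' M)) (hξ : ContDiffOn ℝ ∞ R.ξ (dropU '' M))
    (hθ : ContDiffOn ℝ ∞ R.θ (dropU '' M)) (eτ : ∀ p ∈ M, Q.τ p = R.τ (dropU p))
    (eξ : ∀ p ∈ M, Q.ξ p = R.ξ (dropU p)) (eθ : ∀ p ∈ M, Q.θ p = R.θ (dropU p))
    {p : Fin 4 → ℝ} (hp : p ∈ M) :
    SysDet α Q p ↔ EqDet α R (dropU p) ∧
      α (tx p) * Q.η p = p 2 * (α (tx p) * (pd 3 Q.θ p - pd 1 Q.ξ p)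
        - pd 0 α (tx p) * Q.τ p - pd 1 α (tx p) * Q.ξ p) + pd 1 Q.θ p := by
  have hD := isOpen_image_dropU hM
  obtain ⟨τ0, τ1, τ2, τ3⟩ := pd_of_eq_comp_dropU hM hτ eτ hp
  obtain ⟨ξ0, ξ1, ξ2, ξ3⟩ := pd_of_eq_comp_dropU hM hξ eξ hp
  obtain ⟨θ0, θ1, θ2, θ3⟩ := pd_of_eq_comp_dropU hM hθ eθ hp
  have dθ := fun p hp => pd_of_eq_comp_dropU hM hθ eθ (p := p) hp
  obtain ⟨-, θ11, -, -⟩ := pd_of_eq_comp_dropU hM (contDiffOn_pd hD hθ 1)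
    (fun p hp => (dθ p hp).2.1) hp
  obtain ⟨-, θ13, -, θ33⟩ := pd_of_eq_comp_dropU hM (contDiffOn_pd hD hθ 2)
    (fun p hp => (dθ p hp).2.2.2) hp
  have et := tx_dropU p
  constructor
  · rintro ⟨h1, h2, h3, h4, h5, h6, h7, h8, h9, h10, h11⟩
    refine ⟨⟨?_, ?_, ?_, ?_, ?_, ?_, ?_⟩, h11⟩
    · rwa [← τ1]
    · rwa [← τ3]
    · rwa [← ξ3]
    · rwa [← θ33]
    · rwa [← τ0, ← ξ1]
    · rwa [et, ← θ13, ← ξ0, ← ξ1, ← eτ p hp, ← eξ p hp]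
    · rwa [et, ← θ0, ← θ11, ← θ1]
  · rintro ⟨⟨h4, h5, h6, h7, h8, h9, h10⟩, h11⟩
    refine ⟨τ2, ξ2, θ2, ?_, ?_, ?_, ?_, ?_, ?_, ?_, h11⟩
    · rwa [τ1]
    · rwa [τ3]
    · rwa [ξ3]
    · rwa [θ33]
    · rwa [τ0, ξ1]
    · rwa [et, ← θ13, ← ξ0, ← ξ1, ← eτ p hp, ← eξ p hp] at h9
    · rwa [et, ← θ0, ← θ11, ← θ1] at h10

end Descent

theorem η_formula_iff {A At Ax τ ξ η ξx θx θv u : ℝ} (hA : A ≠ 0) :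
    η = (θv - ξx - At / A * τ - Ax / A * ξ) * u + θx / A ↔
      A * η = u * (A * (θv - ξx) - At * τ - Ax * ξ) + θx := by
  have : A * ((θv - ξx - At / A * τ - Ax / A * ξ) * u + θx / A)
      = u * (A * (θv - ξx) - At * τ - Ax * ξ) + θx := by field_simp
  rw [← this]
  exact (mul_right_inj' hA).symm

/-! ### Truncation and prolongation -/

section Correspondence

variable {Ω : Set (Fin 2 → ℝ)} {α : (Fin 2 → ℝ) → ℝ} {M : Set (Fin 4 → ℝ)} {Q : SysField}
  {R : EqField}

theorem IsSysSymmetry.uFree (hΩ : IsOpen Ω) (hα : ContDiffOn ℝ ∞ α Ω) (hM : IsOpen M)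
    (hMα : ∀ p ∈ M, tx p ∈ Ω ∧ α (tx p) ≠ 0) (hQ : IsSysSymmetry α M Q) :
    UFree M Q.τ ∧ UFree M Q.ξ ∧ UFree M Q.θ := by
  have h := ((isSysSymmetry_iff hΩ hα hM hMα Q).1 hQ).2
  exact ⟨⟨hQ.smooth_τ, fun p hp => (h p hp).τ_u⟩, ⟨hQ.smooth_ξ, fun p hp => (h p hp).ξ_u⟩,
    ⟨hQ.smooth_θ, fun p hp => (h p hp).θ_u⟩⟩

theorem isEqSymmetry_iff_of_isOpen (hΩ : IsOpen Ω) (hα : ContDiffOn ℝ ∞ α Ω) (hM : IsOpen M)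
    (hMα : ∀ p ∈ M, tx p ∈ Ω ∧ α (tx p) ≠ 0) (R : EqField) :
    IsEqSymmetry α (dropU '' M) R ↔ (ContDiffOn ℝ ∞ R.τ (dropU '' M) ∧
      ContDiffOn ℝ ∞ R.ξ (dropU '' M) ∧ ContDiffOn ℝ ∞ R.θ (dropU '' M)) ∧
      ∀ d ∈ dropU '' M, EqDet α R d := by
  have hD : ∀ d ∈ dropU '' M, tx d ∈ Ω ∧ α (tx d) ≠ 0 := by
    rintro _ ⟨p, hp, rfl⟩
    rw [tx_dropU]
    exact hMα p hp
  exact isEqSymmetry_iff (isOpen_image_dropU hM) R (fun d hd => (hD d hd).2)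
    (fun d hd => differentiableAt_of_contDiffOn hΩ hα (hD d hd).1)
    (fun d hd => differentiableAt_of_contDiffOn hΩ (contDiffOn_pd hΩ hα 1) (hD d hd).1)

theorem mapsTo_truncate (hΩ : IsOpen Ω) (hα : ContDiffOn ℝ ∞ α Ω) (hM : IsOpen M)
    (hMα : ∀ p ∈ M, tx p ∈ Ω ∧ α (tx p) ≠ 0)
    (hMu : ∀ t x v : ℝ, Set.OrdConnected {u : ℝ | ![t, x, u, v] ∈ M}) :
    Set.MapsTo (truncate M) (sysSymmetries α M) (eqSymmetries α (dropU '' M)) := by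
  rintro Q ⟨hQ, -⟩
  obtain ⟨uτ, uξ, uθ⟩ := hQ.uFree hΩ hα hM hMα
  have cτ := uτ.contDiffOn_truncFun hM hMu
  have cξ := uξ.contDiffOn_truncFun hM hMu
  have cθ := uθ.contDiffOn_truncFun hM hMu
  refine ⟨(isEqSymmetry_iff_of_isOpen hΩ hα hM hMα _).2 ⟨⟨cτ, cξ, cθ⟩, ?_⟩, fun d hd =>
    ⟨truncFun_of_notMem hd, truncFun_of_notMem hd, truncFun_of_notMem hd⟩⟩
  rintro _ ⟨p, hp, rfl⟩
  exact ((sysDet_iff_eqDet hM cτ cξ cθ (fun p hp => (uτ.truncFun_dropU hM hMu hp).symm)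
    (fun p hp => (uξ.truncFun_dropU hM hMu hp).symm)
    (fun p hp => (uθ.truncFun_dropU hM hMu hp).symm) hp).1
    (((isSysSymmetry_iff hΩ hα hM hMα Q).1 hQ).2 p hp)).1

theorem prolong_apply {p : Fin 4 → ℝ} (hp : p ∈ M) :
    (prolong α M R).τ p = R.τ (dropU p) ∧ (prolong α M R).ξ p = R.ξ (dropU p) ∧
    (prolong α M R).η p =
      (pd 2 R.θ (dropU p) - pd 1 R.ξ (dropU p) - pd 0 α (tx p) / α (tx p) * R.τ (dropU p)
        - pd 1 α (tx p) / α (tx p) * R.ξ (dropU p)) * p 2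
      + pd 1 R.θ (dropU p) / α (tx p) ∧
    (prolong α M R).θ p = R.θ (dropU p) := by
  simp [prolong, hp]

theorem contDiffOn_prolong_η (hΩ : IsOpen Ω) (hα : ContDiffOn ℝ ∞ α Ω) (hM : IsOpen M)
    (hMα : ∀ p ∈ M, tx p ∈ Ω ∧ α (tx p) ≠ 0) (hR : IsEqSymmetry α (dropU '' M) R) :
    ContDiffOn ℝ ∞ (prolong α M R).η M := by
  have hD := isOpen_image_dropU hM
  have lift := fun {g : (Fin 3 → ℝ) → ℝ} (hg : ContDiffOn ℝ ∞ g (dropU '' M)) =>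
    contDiffOn_of_eq_comp_dropU (f := fun p => g (dropU p)) hg fun _ _ => rfl
  have liftα := fun {g : (Fin 2 → ℝ) → ℝ} (hg : ContDiffOn ℝ ∞ g Ω) =>
    (hg.comp (contDiff_tx (n := 2)).contDiffOn fun p hp => (hMα p hp).1 :
      ContDiffOn ℝ ∞ (fun p : Fin 4 → ℝ => g (tx p)) M)
  have h0 := fun p hp => (hMα p hp).2
  have hu : ContDiffOn ℝ ∞ (fun p : Fin 4 → ℝ => p 2) M :=
    (contDiff_apply ℝ ℝ (2 : Fin 4)).contDiffOn
  refine ContDiffOn.congr ?_ fun p hp => (prolong_apply hp).2.2.1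
  exact (((((lift (contDiffOn_pd hD hR.smooth_θ 2)).sub
    (lift (contDiffOn_pd hD hR.smooth_ξ 1))).sub
    (((liftα (contDiffOn_pd hΩ hα 0)).div (liftα hα) h0).mul (lift hR.smooth_τ))).sub
    (((liftα (contDiffOn_pd hΩ hα 1)).div (liftα hα) h0).mul (lift hR.smooth_ξ))).mul hu).add
    ((lift (contDiffOn_pd hD hR.smooth_θ 1)).div (liftα hα) h0)

theorem mapsTo_prolong (hΩ : IsOpen Ω) (hα : ContDiffOn ℝ ∞ α Ω) (hM : IsOpen M)
    (hMα : ∀ p ∈ M, tx p ∈ Ω ∧ α (tx p) ≠ 0) :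
    Set.MapsTo (prolong α M) (eqSymmetries α (dropU '' M)) (sysSymmetries α M) := by
  rintro R ⟨hR, -⟩
  have eτ : ∀ p ∈ M, (prolong α M R).τ p = R.τ (dropU p) := fun p hp =>
    (prolong_apply hp).1
  have eξ : ∀ p ∈ M, (prolong α M R).ξ p = R.ξ (dropU p) := fun p hp =>
    (prolong_apply hp).2.1
  have eθ : ∀ p ∈ M, (prolong α M R).θ p = R.θ (dropU p) := fun p hp =>
    (prolong_apply hp).2.2.2
  refine ⟨(isSysSymmetry_iff hΩ hα hM hMα _).2
    ⟨⟨contDiffOn_of_eq_comp_dropU hR.smooth_τ eτ, contDiffOn_of_eq_comp_dropU hR.smooth_ξ eξ,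
      contDiffOn_prolong_η hΩ hα hM hMα hR, contDiffOn_of_eq_comp_dropU hR.smooth_θ eθ⟩,
      fun p hp => ?_⟩, fun p hp => by simp [prolong, hp]⟩
  refine (sysDet_iff_eqDet hM hR.smooth_τ hR.smooth_ξ hR.smooth_θ eτ eξ eθ hp).2
    ⟨((isEqSymmetry_iff_of_isOpen hΩ hα hM hMα R).1 hR).2 _ ⟨p, hp, rfl⟩, ?_⟩
  rw [← η_formula_iff (hMα p hp).2, eτ p hp, eξ p hp,
    (pd_of_eq_comp_dropU hM hR.smooth_θ eθ hp).2.2.2,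
    (pd_of_eq_comp_dropU hM hR.smooth_θ eθ hp).2.1,
    (pd_of_eq_comp_dropU hM hR.smooth_ξ eξ hp).2.1]
  exact (prolong_apply hp).2.2.1

theorem leftInvOn_prolong (hΩ : IsOpen Ω) (hα : ContDiffOn ℝ ∞ α Ω) (hM : IsOpen M)
    (hMα : ∀ p ∈ M, tx p ∈ Ω ∧ α (tx p) ≠ 0)
    (hMu : ∀ t x v : ℝ, Set.OrdConnected {u : ℝ | ![t, x, u, v] ∈ M}) :
    Set.LeftInvOn (prolong α M) (truncate M) (sysSymmetries α M) := by
  rintro Q ⟨hQ, hQ0⟩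
  obtain ⟨uτ, uξ, uθ⟩ := hQ.uFree hΩ hα hM hMα
  have eτ := fun p hp => uτ.truncFun_dropU hM hMu (p := p) hp
  have eξ := fun p hp => uξ.truncFun_dropU hM hMu (p := p) hp
  have eθ := fun p hp => uθ.truncFun_dropU hM hMu (p := p) hp
  have ext : ∀ f g : (Fin 4 → ℝ) → ℝ, (∀ p ∉ M, f p = 0) → (∀ p ∈ M, g p = f p) →
      M.indicator g = f := by
    intro f g h0 h1
    ext p
    by_cases hp : p ∈ M
    · rw [Set.indicator_of_mem hp, h1 p hp]
    · rw [Set.indicator_of_notMem hp, h0 p hp]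
  have e1 : (prolong α M (truncate M Q)).τ = Q.τ := ext _ _ (fun p hp => (hQ0 p hp).1) eτ
  have e2 : (prolong α M (truncate M Q)).ξ = Q.ξ := ext _ _ (fun p hp => (hQ0 p hp).2.1) eξ
  have e4 : (prolong α M (truncate M Q)).θ = Q.θ := ext _ _ (fun p hp => (hQ0 p hp).2.2.2) eθ
  have e3 : (prolong α M (truncate M Q)).η = Q.η := by
    refine ext _ _ (fun p hp => (hQ0 p hp).2.2.1) fun p hp => ?_
    have hd := (((isSysSymmetry_iff hΩ hα hM hMα Q).1 hQ).2 p hp).η_eq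
    rw [← η_formula_iff (hMα p hp).2] at hd
    have dθ := pd_of_eq_comp_dropU hM (uθ.contDiffOn_truncFun hM hMu)
      (fun p hp => (eθ p hp).symm) hp
    have dξ := pd_of_eq_comp_dropU hM (uξ.contDiffOn_truncFun hM hMu)
      (fun p hp => (eξ p hp).symm) hp
    rw [hd, dθ.2.2.2, dθ.2.1, dξ.2.1, ← eτ p hp, ← eξ p hp]
    rfl
  cases Q
  cases h : prolong α M (truncate M _)
  simp_all

theorem rightInvOn_prolong :
    Set.RightInvOn (prolong α M) (truncate M) (eqSymmetries α (dropU '' M)) := by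
  rintro R ⟨-, hR0⟩
  have ext : ∀ f : (Fin 3 → ℝ) → ℝ, (∀ d ∉ dropU '' M, f d = 0) →
      truncFun M (M.indicator fun p => f (dropU p)) = f := by
    intro f h0
    ext d
    by_cases hd : d ∈ dropU '' M
    · exact truncFun_dropU_of_eqOn (fun p hp => Set.indicator_of_mem hp _) hd
    · rw [truncFun_of_notMem hd, h0 d hd]
  have e1 : (truncate M (prolong α M R)).τ = R.τ := ext _ fun d hd => (hR0 d hd).1
  have e2 : (truncate M (prolong α M R)).ξ = R.ξ := ext _ fun d hd => (hR0 d hd).2.1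
  have e3 : (truncate M (prolong α M R)).θ = R.θ := ext _ fun d hd => (hR0 d hd).2.2
  cases R
  cases h : truncate M (prolong α M _)
  simp_all

/-- Since `τ_v = ξ_v = θ_vv = 0`, the only `v`-derivative that can be nonzero is
`η_v = θ_xv / α`. -/
theorem isPurePotential_iff (hΩ : IsOpen Ω) (hα : ContDiffOn ℝ ∞ α Ω) (hM : IsOpen M)
    (hMα : ∀ p ∈ M, tx p ∈ Ω ∧ α (tx p) ≠ 0) (hQ : IsSysSymmetry α M Q) :
    IsPurePotential M Q ↔ ∃ p ∈ M, pd 1 (pd 3 Q.θ) p ≠ 0 := by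
  have hd := ((isSysSymmetry_iff hΩ hα hM hMα Q).1 hQ).2
  obtain ⟨uτ, uξ, uθ⟩ := hQ.uFree hΩ hα hM hMα
  refine exists_congr fun p => and_congr_right fun hp => ?_
  obtain ⟨-, h, -⟩ := pd_η hΩ hα hM (fun p hp => (hMα p hp).1) uτ uξ uθ hQ.smooth_η
    (fun p hp => (hd p hp).τ_x) (fun p hp => (hd p hp).τ_v) (fun p hp => (hd p hp).ξ_v)
    (fun p hp => (hd p hp).η_eq) hp
  rw [(hd p hp).θ_vv, mul_zero, mul_zero, zero_add] at h
  simp [(hd p hp).τ_v, (hd p hp).ξ_v, ← h, (hMα p hp).2]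

theorem exists_isPurePotential_iff (hΩ : IsOpen Ω) (hα : ContDiffOn ℝ ∞ α Ω) (hM : IsOpen M)
    (hMα : ∀ p ∈ M, tx p ∈ Ω ∧ α (tx p) ≠ 0)
    (hMu : ∀ t x v : ℝ, Set.OrdConnected {u : ℝ | ![t, x, u, v] ∈ M}) :
    (∃ Q ∈ sysSymmetries α M, IsPurePotential M Q) ↔
      ∃ Q ∈ eqSymmetries α (dropU '' M), ∃ d ∈ dropU '' M, pd 1 (pd 2 Q.θ) d ≠ 0 := by
  have hD := isOpen_image_dropU hM
  have key : ∀ (f : (Fin 4 → ℝ) → ℝ) (g : (Fin 3 → ℝ) → ℝ),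
      ContDiffOn ℝ ∞ g (dropU '' M) → (∀ p ∈ M, f p = g (dropU p)) →
      ∀ p ∈ M, pd 1 (pd 3 f) p = pd 1 (pd 2 g) (dropU p) := fun f g hg hfg p hp =>
    (pd_of_eq_comp_dropU hM (contDiffOn_pd hD hg 2)
      (fun p hp => (pd_of_eq_comp_dropU hM hg hfg hp).2.2.2) hp).2.1
  constructor
  · rintro ⟨Q, hQ, hpure⟩
    obtain ⟨p, hp, hne⟩ := (isPurePotential_iff hΩ hα hM hMα hQ.1).1 hpure
    have hT := mapsTo_truncate hΩ hα hM hMα hMu hQ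
    refine ⟨_, hT, dropU p, ⟨p, hp, rfl⟩, ?_⟩
    rwa [← key Q.θ _ hT.1.smooth_θ
      (fun p hp => ((hQ.1.uFree hΩ hα hM hMα).2.2.truncFun_dropU hM hMu hp).symm) p hp]
  · rintro ⟨R, hR, _, ⟨p, hp, rfl⟩, hne⟩
    have hP := mapsTo_prolong hΩ hα hM hMα hR
    refine ⟨_, hP, (isPurePotential_iff hΩ hα hM hMα hP.1).2 ⟨p, hp, ?_⟩⟩
    rwa [key _ R.θ hR.1.smooth_θ (fun p hp => (prolong_apply hp).2.2.2) p hp]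

end Correspondence

end PotSym

end

theorem mainTheorem3
    (Ω : Set (Fin 2 → ℝ)) (hΩ : IsOpen Ω)
    (α : (Fin 2 → ℝ) → ℝ) (hα : ContDiffOn ℝ ∞ α Ω) (hheat : PotSym.BackwardHeat Ω α)
    (M : Set (Fin 4 → ℝ)) (hM : IsOpen M)
    (hMα : ∀ p ∈ M, PotSym.tx p ∈ Ω ∧ α (PotSym.tx p) ≠ 0)
    (hMu : ∀ t x v : ℝ, Set.OrdConnected {u : ℝ | ![t, x, u, v] ∈ M}) :
    -- determining equations; in particular `τ`, `ξ`, `θ` do not depend on `u`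
    (∀ Q ∈ PotSym.sysSymmetries α M, ∀ p ∈ M,
      (PotSym.pd 2 Q.τ p = 0 ∧ PotSym.pd 2 Q.ξ p = 0 ∧ PotSym.pd 2 Q.θ p = 0) ∧
      (PotSym.pd 1 Q.τ p = 0 ∧ PotSym.pd 3 Q.τ p = 0 ∧ PotSym.pd 3 Q.ξ p = 0 ∧
        PotSym.pd 3 (PotSym.pd 3 Q.θ) p = 0) ∧
      Q.η p = (PotSym.pd 3 Q.θ p - PotSym.pd 1 Q.ξ p
            - PotSym.pd 0 α (PotSym.tx p) / α (PotSym.tx p) * Q.τ p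
            - PotSym.pd 1 α (PotSym.tx p) / α (PotSym.tx p) * Q.ξ p) * p 2
          + PotSym.pd 1 Q.θ p / α (PotSym.tx p)) ∧
    -- truncation just drops the term `η ∂_u`
    (∀ Q ∈ PotSym.sysSymmetries α M, ∀ p ∈ M,
      (PotSym.truncate M Q).τ (PotSym.dropU p) = Q.τ p ∧
      (PotSym.truncate M Q).ξ (PotSym.dropU p) = Q.ξ p ∧
      (PotSym.truncate M Q).θ (PotSym.dropU p) = Q.θ p) ∧
    -- it is a bijection between Lie symmetry operators, and its inverse is prolongation
    Set.BijOn (PotSym.truncate M) (PotSym.sysSymmetries α M)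
      (PotSym.eqSymmetries α (PotSym.dropU '' M)) ∧
    Set.BijOn (PotSym.prolong α M) (PotSym.eqSymmetries α (PotSym.dropU '' M))
      (PotSym.sysSymmetries α M) ∧
    Set.InvOn (PotSym.prolong α M) (PotSym.truncate M) (PotSym.sysSymmetries α M)
      (PotSym.eqSymmetries α (PotSym.dropU '' M)) ∧
    -- pure potential symmetries
    ((∃ Q ∈ PotSym.sysSymmetries α M, PotSym.IsPurePotential M Q) ↔
      ∃ Q ∈ PotSym.eqSymmetries α (PotSym.dropU '' M),
        ∃ d ∈ PotSym.dropU '' M, PotSym.pd 1 (PotSym.pd 2 Q.θ) d ≠ 0) := by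
  have hinv : Set.InvOn (PotSym.prolong α M) (PotSym.truncate M) (PotSym.sysSymmetries α M)
      (PotSym.eqSymmetries α (PotSym.dropU '' M)) :=
    ⟨PotSym.leftInvOn_prolong hΩ hα hM hMα hMu, PotSym.rightInvOn_prolong⟩
  have hT := PotSym.mapsTo_truncate hΩ hα hM hMα hMu
  have hP := PotSym.mapsTo_prolong hΩ hα hM hMα
  refine ⟨fun Q hQ p hp => ?_, fun Q hQ p hp => ?_, hinv.bijOn hT hP, hinv.symm.bijOn hP hT,
    hinv, PotSym.exists_isPurePotential_iff hΩ hα hM hMα hMu⟩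
  · have h := ((PotSym.isSysSymmetry_iff hΩ hα hM hMα Q).1 hQ.1).2 p hp
    exact ⟨⟨h.τ_u, h.ξ_u, h.θ_u⟩, ⟨h.τ_x, h.τ_v, h.ξ_v, h.θ_vv⟩,
      (PotSym.η_formula_iff (hMα p hp).2).2 h.η_eq⟩
  · obtain ⟨uτ, uξ, uθ⟩ := hQ.1.uFree hΩ hα hM hMα
    exact ⟨uτ.truncFun_dropU hM hMu hp, uξ.truncFun_dropU hM hMu hp,
      uθ.truncFun_dropU hM hMu hp⟩
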